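/- **Theorem.** Let $N \ge 1$ be an integer, $a > -1$ and $k$ real. For a weight function $w$ on $\mathbb R$, the corresponding unitary ensemble is the ensemble of $N$ eigenvalues with joint probability density $$P_N(\lambda_1,\dots,\lambda_N) = \frac1{C_N} \prod_{l=1}^N w(\lambda_l) \prod_{1\le j<l\le N} |\lambda_l-\lambda_j|^2 ,$$ and $m$-point correlation function $$\rho_{(m)}(\lambda_1,\dots,\lambda_m) = \frac{N!}{(N-m)!}\int_{\mathbb R^{N-m}} P_N(\lambda_1,\dots,\lambda_N)\, d\lambda_{m+1}\cdots d\lambda_N$$ (interpreted as $0$ if $m>N$). The truncated two-point function is $\rho_{(2)}^{T}(x,y) = \rho_{(2)}(x,y) - \rho_{(1)}(x)\rho_{(1)}(y)$, and the structure function is $$S_N(k) = \Big\langle \Big|\sum_{j=1}^N e^{ik\lambda_j}\Big|^2\Big\rangle - \Big|\Big\langle \sum_{j=1}^N e^{ik\lambda_j}\Big\rangle\Big|^2 .$$ A superscript $(L)$ refers to the Laguerre unitary ensemble (LUE), $w(x) = x^a e^{-x}\chi_{x>0}$, and a superscript $(J)$ to the Jacobi unitary ensemble (JUE), $w(x) =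 x^a(1-x)^b\chi_{0<x<1}$, with the same $N$ and $a$. Then, the integrals being absolutely convergent, $$-\int_{\mathbb R_+^2} e^{ik(x-y)} \rho_{(2)}^{T,(L)}(x,y)\, dx\, dy = \int_0^{1/(1+k^2)} \rho_{(1)}^{(J)}(x)\Big|_{b=0}\, dx .$$ Equivalently, $$S_N^{(L)}(k) = \int_{1/(1+k^2)}^1 \rho_{(1)}^{(J)}(x)\Big|_{b=0}\, dx .$$ -/

import Mathlib

open MeasureTheory Finset

noncomputable section

namespace UnitaryEnsemble

/-- The Laguerre weight `x ^ a * exp (-x)`, supported on `x > 0`. -/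
def laguerreWeight (a : ℝ) : ℝ → ℝ :=
  Set.indicator (Set.Ioi 0) fun x => x ^ a * Real.exp (-x)

/-- The Jacobi weight `x ^ a * (1 - x) ^ b`, supported on `0 < x < 1`. -/
def jacobiWeight (a b : ℝ) : ℝ → ℝ :=
  Set.indicator (Set.Ioo 0 1) fun x => x ^ a * (1 - x) ^ b

/-- The unnormalised eigenvalue density
`∏_l w (x_l) * ∏_{j < k} |x_k - x_j| ^ 2` of the unitary ensemble with weight `w`. -/
def weightProduct (w : ℝ → ℝ) (N : ℕ) (x : Fin N → ℝ) : ℝ :=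
  (∏ l, w (x l)) * ∏ j : Fin N, ∏ k ∈ Ioi j, |x k - x j| ^ 2

/-- The normalisation constant of the unitary ensemble with weight `w`. -/
def normalization (w : ℝ → ℝ) (N : ℕ) : ℝ :=
  ∫ x : Fin N → ℝ, weightProduct w N x

/-- The joint eigenvalue probability density function of the unitary ensemble with weight `w`. -/
def jointDensity (w : ℝ → ℝ) (N : ℕ) (x : Fin N → ℝ) : ℝ :=
  (normalization w N)⁻¹ * weightProduct w N x

/-- The average of a function of the eigenvalues. -/
def average {E : Type*} [NormedAddCommGroup E] [NormedSpace ℝ E]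
    (w : ℝ → ℝ) (N : ℕ) (f : (Fin N → ℝ) → E) : E :=
  ∫ x : Fin N → ℝ, jointDensity w N x • f x

/-- The point `(x_1, …, x_m, y_1, …, y_{N-m})`. -/
def joinCoords {N m : ℕ} (x : Fin m → ℝ) (y : Fin (N - m) → ℝ) (i : Fin N) : ℝ :=
  if h : (i : ℕ) < m then x ⟨i, h⟩ else y ⟨(i : ℕ) - m, by omega⟩

/-- The `m`-point correlation function: `N! / (N - m)!` (which is
`N (N - 1) ⋯ (N - m + 1)`, and so `0` for `m > N`) times the integral of the joint density over
the last `N - m` eigenvalues. -/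
def correlation (w : ℝ → ℝ) (N m : ℕ) (x : Fin m → ℝ) : ℝ :=
  (N.descFactorial m : ℝ) * ∫ y : Fin (N - m) → ℝ, jointDensity w N (joinCoords x y)

/-- The eigenvalue density, i.e. the one-point correlation function. -/
def eigenvalueDensity (w : ℝ → ℝ) (N : ℕ) (x : ℝ) : ℝ :=
  correlation w N 1 ![x]

/-- The truncated two-point correlation function. -/
def truncatedTwoPoint (w : ℝ → ℝ) (N : ℕ) (x y : ℝ) : ℝ :=
  correlation w N 2 ![x, y] - eigenvalueDensity w N x * eigenvalueDensity w N y

/-- The linear statistic `∑_j exp (i k x_j)`. -/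
def expSum (N : ℕ) (k : ℝ) (x : Fin N → ℝ) : ℂ :=
  ∑ j, Complex.exp (Complex.I * k * x j)

/-- The structure function
`⟨|∑_j exp (i k x_j)| ^ 2⟩ - |⟨∑_j exp (i k x_j)⟩| ^ 2`. -/
def structureFunction (w : ℝ → ℝ) (N : ℕ) (k : ℝ) : ℝ :=
  average w N (fun x => ‖expSum N k x‖ ^ 2) - ‖average w N (expSum N k)‖ ^ 2

end UnitaryEnsemble

end

/-!
Let `t = 1 / (1 + k ^ 2)`, `s = a + 1`, and let `φ_n` be the orthonormal Laguerre functions.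

The unitary ensemble of a weight is determinantal. With the polynomials `p n` orthonormal for the
weight, the squared Vandermonde determinant becomes a double sum over permutations
(`mixedDiscriminant`), in which orthonormality integrates out all but one or two eigenvalues. Hence
`ρ₁ x = K(x, x)` and `ρ₂ᵀ(x, y) = -K(x, y) ^ 2` (`IsOrthonormal.eigenvalueDensity_eq`,
`IsOrthonormal.truncatedTwoPoint_eq`), and both forms of the theorem reduce to
`∑_{m, n < N} |U_{mn}(k)| ^ 2 = ∫_0^t ρ₁^J`, where `U_{mn}(k) = ∫ exp (i k x) φ_m φ_n dx`
(`IsOrthonormal.structureFunction_eq`, `IsOrthonormal.integral_exp_mul_truncatedTwoPoint`,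
`sum_norm_expMoment_sq`).

This identity is additive in `N`. The Jacobi polynomials `P_n` with parameters `(0, a)` on `[0, 1]`,
normalised by `P_n 1 = 1`, have squared norm `1 / (2 n + s)`, so that
`ρ₁^J x = ∑_{n < N} (2 n + s) x ^ a P_n(x) ^ 2`. It is therefore enough that
`g_n(k) := |U_{nn}| ^ 2 + 2 ∑_{m < n} |U_{mn}| ^ 2` equals `∫_0^t (2 n + s) x ^ a P_n(x) ^ 2 dx`
(`hookSum_eq_integral`). Both are `1` at `k = 0`, and their derivatives in `k` agree:

* `U' = i X U`, where `X` is the symmetric tridiagonal matrix of multiplication by `x`, so the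
  derivative of `∑_{m ≤ M} |U_{mn}| ^ 2` telescopes to one boundary term
  (`hasDerivAt_sum_norm_laguerreFourier_sq`).
* Integration by parts turns the two boundary terms of `g_n'` into
  `-2 k Im (conj U_{nn} * U_{nn}')` (`laguerreFourier_succ_sub_pred`).
* The multiplication theorem for Laguerre polynomials gives `U_{nn} = ζ ^ s (2 ζ - 1) ^ n P_n(t)`
  with `ζ = 1 / (1 - i k)` (`laguerreFourier_self`). As `|ζ| ^ 2 = t` and `|2 ζ - 1| = 1`, this
  yields
  `|U_{nn}| ^ 2 = t ^ s P_n(t) ^ 2` and the phase velocity `(2 n + s) t`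
  (`im_conj_laguerreFourier_mul_deriv`).

Integrals over the half-line are reduced to algebra by the Fourier transform of the gamma density
(`gammaFourier_eq`). Up to normalisation, Laguerre polynomials are the images of `(1 - X) ^ n` under
the linear map `X ^ j ↦ X ^ j / (s (s + 1) ⋯ (s + j - 1))`, and orthogonality of both the Laguerre
and the Jacobi polynomials comes down to the vanishing of an `n`-th finite difference of a
polynomial of degree less than `n` (`sum_choose_mul_ascPochhammer_eq_zero`).
-/

namespace UnitaryEnsemble

/-! ### Mixed discriminants -/

open Equiv in
/-- The sum `∑ σ τ, sgn σ * sgn τ * ∏ i, A i (σ i) (τ i)`: the mixed discriminant of the matrices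
`A i`, without the customary normalisation by `1 / n!`. -/
def mixedDiscriminant {ι R : Type*} [Fintype ι] [DecidableEq ι] [CommRing R]
    (A : ι → Matrix ι ι R) : R :=
  ∑ σ : Perm ι, ∑ τ : Perm ι,
    ((Perm.sign σ : ℤ) : R) * ((Perm.sign τ : ℤ) : R) * ∏ i, A i (σ i) (τ i)

section Combinatorics

open Equiv

variable {ι R : Type*} [Fintype ι] [DecidableEq ι] [CommRing R]

lemma mixedDiscriminant_eq_sum_det (A : ι → Matrix ι ι R) :
    mixedDiscriminant A = ∑ σ : Perm ι, (Matrix.of fun i j => A i (σ i) (σ j)).det := by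
  unfold mixedDiscriminant
  refine Finset.sum_congr rfl fun σ _ => ?_
  rw [← Matrix.det_transpose, Matrix.det_apply']
  rw [← Equiv.sum_comp (Equiv.mulLeft σ)]
  refine Finset.sum_congr rfl fun π _ => ?_
  have h : ((Perm.sign σ : ℤ) : R) * ((Perm.sign σ : ℤ) : R) = 1 := by
    rw [← Int.cast_mul, ← Units.val_mul, Int.units_mul_self]; simp
  simp only [Equiv.coe_mulLeft, Perm.sign_mul, Units.val_mul, Int.cast_mul, Matrix.transpose_apply,
    Matrix.of_apply, Perm.mul_apply]
  rw [← mul_assoc, h, one_mul]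

lemma det_eq_of_rows_single {M : Matrix ι ι R} {j l : ι} (hjl : j ≠ l)
    (hM : ∀ i, i ≠ j → i ≠ l → M i = Pi.single i 1) :
    M.det = M j j * M l l - M j l * M l j := by
  rw [← Matrix.det_transpose, Matrix.det_apply']
  have hsub : ({1, swap j l} : Finset (Perm ι)) ⊆ univ := Finset.subset_univ _
  rw [← Finset.sum_subset hsub]
  · have hne : (1 : Perm ι) ≠ swap j l := fun h => hjl (by
      have := congrArg (fun π : Perm ι => π j) h
      simpa using this)
    have hprod : ∀ π : Perm ι, (∀ i, i ≠ j → i ≠ l → π i = i) →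
        ∏ i, M.transpose (π i) i = M j (π j) * M l (π l) := by
      intro π hπ
      rw [← Finset.prod_subset (Finset.subset_univ {j, l}), Finset.prod_pair hjl]
      · simp
      · intro i _ hi
        simp only [Finset.mem_insert, Finset.mem_singleton, not_or] at hi
        simp [hM i hi.1 hi.2, hπ i hi.1 hi.2]
    rw [Finset.sum_pair hne, hprod 1 (by simp), hprod (swap j l)
      (fun i hj hl => swap_apply_of_ne_of_ne hj hl)]
    simp [Perm.sign_swap hjl]
    ring
  · intro π _ hπ
    simp only [Finset.mem_insert, Finset.mem_singleton, not_or] at hπ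
    -- a permutation other than `1` and `swap j l` moves some index outside `{j, l}`
    have : ∃ i, i ≠ j ∧ i ≠ l ∧ π i ≠ i := by
      by_contra! hcon
      have key : ∀ x, x = j ∨ x = l → π x = j ∨ π x = l := by
        intro x hx
        by_contra! h
        have h1 := π.injective (hcon _ h.1 h.2)
        rcases hx with rfl | rfl
        · exact h.1 h1
        · exact h.2 h1
      rcases key j (Or.inl rfl) with hj | hj
      · rcases key l (Or.inr rfl) with hl | hl
        · exact hjl (π.injective (hj.trans hl.symm))
        · apply hπ.1
          ext x
          by_cases h1 : x = j
          · simp [h1, hj]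
          by_cases h2 : x = l
          · simp [h2, hl]
          simp [hcon x h1 h2]
      · rcases key l (Or.inr rfl) with hl | hl
        · apply hπ.2
          ext x
          by_cases h1 : x = j
          · simp [h1, hj]
          by_cases h2 : x = l
          · simp [h2, hl]
          rw [hcon x h1 h2, swap_apply_of_ne_of_ne h1 h2]
        · exact absurd (π.injective (hj.trans hl.symm)) hjl
    obtain ⟨i, hj, hl, hi⟩ := this
    rw [Finset.prod_eq_zero (Finset.mem_univ i), mul_zero]
    simp [hM i hj hl, hi]

lemma det_eq_of_rows_single_one {M : Matrix ι ι R} {j : ι}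
    (hM : ∀ i, i ≠ j → M i = Pi.single i 1) : M.det = M j j := by
  rw [← Matrix.det_transpose, Matrix.det_apply', Finset.sum_eq_single 1]
  · simp only [Perm.sign_one, Units.val_one, Int.cast_one, Perm.one_apply, one_mul,
      Matrix.transpose_apply]
    exact Finset.prod_eq_single j (fun i _ hi => by simp [hM i hi]) (by simp)
  · intro π _ hπ
    have : ∃ i, i ≠ j ∧ π i ≠ i := by
      by_contra! hcon
      apply hπ
      ext x
      by_cases h1 : x = j
      · by_contra h2
        have h3 : π x ≠ j := fun h => h2 (by rw [h, h1]; rfl)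
        exact h3 ((π.injective (hcon _ h3)).trans h1)
      · simp [hcon x h1]
    obtain ⟨i, hj, hi⟩ := this
    rw [Finset.prod_eq_zero (Finset.mem_univ i), mul_zero]
    simp [hM i hj, hi]
  · simp

lemma mixedDiscriminant_eq_of_forall_ne {A : ι → Matrix ι ι R} {j : ι}
    (hA : ∀ i, i ≠ j → A i = 1) :
    mixedDiscriminant A = ∑ σ : Perm ι, A j (σ j) (σ j) := by
  rw [mixedDiscriminant_eq_sum_det]
  refine Finset.sum_congr rfl fun σ _ => ?_
  rw [det_eq_of_rows_single_one (j := j)]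
  · rfl
  · intro i hi
    ext x
    simp [hA i hi, Matrix.one_apply, Pi.single_apply, eq_comm]

lemma mixedDiscriminant_eq_of_forall_ne_ne {A : ι → Matrix ι ι R} {j l : ι} (hjl : j ≠ l)
    (hA : ∀ i, i ≠ j → i ≠ l → A i = 1) :
    mixedDiscriminant A = ∑ σ : Perm ι,
      (A j (σ j) (σ j) * A l (σ l) (σ l) - A j (σ j) (σ l) * A l (σ l) (σ j)) := by
  rw [mixedDiscriminant_eq_sum_det]
  refine Finset.sum_congr rfl fun σ _ => ?_
  rw [det_eq_of_rows_single hjl]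
  · rfl
  · intro i hi hi'
    ext x
    simp [hA i hi hi', Matrix.one_apply, Pi.single_apply, eq_comm]

lemma mixedDiscriminant_one :
    mixedDiscriminant (fun _ : ι => (1 : Matrix ι ι R)) = (Fintype.card ι).factorial := by
  rw [mixedDiscriminant_eq_sum_det]
  have : ∀ σ : Perm ι, (Matrix.of fun i j => (1 : Matrix ι ι R) (σ i) (σ j)) = 1 := by
    intro σ; ext i j; simp [Matrix.one_apply]
  simp [this, Fintype.card_perm]

lemma card_mul_sum_perm_apply (j : ι) (F : ι → R) :
    (Fintype.card ι : R) * ∑ σ : Perm ι, F (σ j) = (Fintype.card ι).factorial * ∑ p, F p := by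
  have h1 : ∀ i : ι, ∑ σ : Perm ι, F (σ i) = ∑ σ : Perm ι, F (σ j) := by
    intro i
    rw [← Equiv.sum_comp (Equiv.mulRight (swap i j))]
    simp
  have h2 : ∑ i : ι, ∑ σ : Perm ι, F (σ i) = (Fintype.card ι).factorial * ∑ p, F p := by
    rw [Finset.sum_comm]
    simp [Equiv.sum_comp, Fintype.card_perm]
  rw [← h2, Finset.sum_congr rfl fun i _ => h1 i]
  simp

lemma sum_perm_sum_apply (F : ι → R) :
    ∑ j, ∑ σ : Perm ι, F (σ j) = (Fintype.card ι).factorial * ∑ p, F p := by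
  rw [Finset.sum_comm]
  simp [Equiv.sum_comp, Fintype.card_perm]

lemma sum_perm_sum_apply_apply (F : ι → ι → R) :
    ∑ j, ∑ l, ∑ σ : Perm ι, F (σ j) (σ l) = (Fintype.card ι).factorial * ∑ p, ∑ q, F p q := by
  have : ∀ σ : Perm ι, ∑ j, ∑ l, F (σ j) (σ l) = ∑ p, ∑ q, F p q := by
    intro σ
    rw [← Equiv.sum_comp σ fun p => ∑ q, F p q]
    exact Finset.sum_congr rfl fun j _ => Equiv.sum_comp σ (F (σ j))
  rw [Finset.sum_congr rfl fun j _ => Finset.sum_comm, Finset.sum_comm]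
  simp [this, Fintype.card_perm]

lemma card_mul_sum_perm_apply_apply {j l : ι} (hjl : j ≠ l) (F : ι → ι → R)
    (hF : ∀ p, F p p = 0) :
    ((Fintype.card ι : R) * (Fintype.card ι - 1)) * ∑ σ : Perm ι, F (σ j) (σ l) =
      (Fintype.card ι).factorial * ∑ p, ∑ q, F p q := by
  have h1 : ∀ i m : ι, i ≠ m →
      ∑ σ : Perm ι, F (σ i) (σ m) = ∑ σ : Perm ι, F (σ j) (σ l) := by
    intro i m him
    -- `π` maps `(i, m)` to `(j, l)`
    obtain ⟨π, hπ⟩ : ∃ π : Perm ι, π = swap (swap i j m) l * swap i j := ⟨_, rfl⟩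
    have hi : π i = j := by
      rw [hπ, Perm.mul_apply, swap_apply_left]
      refine swap_apply_of_ne_of_ne (fun h => him ?_) hjl
      have := congrArg (swap i j) h
      simpa using this
    have hm : π m = l := by
      rw [hπ, Perm.mul_apply, swap_apply_left]
    rw [← Equiv.sum_comp (Equiv.mulRight π)]
    simp only [Equiv.coe_mulRight, Perm.mul_apply, hi, hm]
  rw [← sum_perm_sum_apply_apply]
  generalize ∑ σ : Perm ι, F (σ j) (σ l) = S at h1
  have h2 : ∀ i m : ι, ∑ σ : Perm ι, F (σ i) (σ m) = S - if i = m then S else 0 := by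
    intro i m
    split_ifs with h
    · simp [h, hF]
    · simp [h1 i m h]
  simp only [h2, Finset.sum_sub_distrib, Finset.sum_ite_eq, Finset.mem_univ, if_true,
    Finset.sum_const, Finset.card_univ, nsmul_eq_mul]
  ring

end Combinatorics

/-! ### Unitary ensembles in terms of orthonormal polynomials -/

open Polynomial

/-- `p 0, p 1, …` are polynomials with `deg (p n) ≤ n`, orthonormal for a weight function `w` all of
whose moments exist. (Orthonormality forces `deg (p n) = n`.) -/
structure IsOrthonormal (w : ℝ → ℝ) (p : ℕ → ℝ[X]) : Prop where
  integrable : ∀ q : ℝ[X], Integrable fun x => w x * q.eval x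
  natDegree_le : ∀ n, (p n).natDegree ≤ n
  integral_eq : ∀ m n, ∫ x, w x * ((p m).eval x * (p n).eval x) = if m = n then 1 else 0

/-- The rank-one matrix `w x * p m x * p n x`, whose integral over `x` is the identity matrix when
`p` is orthonormal for `w`. -/
noncomputable def pointMatrix (w : ℝ → ℝ) (p : ℕ → ℝ[X]) (N : ℕ) (x : ℝ) :
    Matrix (Fin N) (Fin N) ℝ :=
  Matrix.of fun m n => w x * ((p m).eval x * (p n).eval x)

/-- The squared Vandermonde determinant as a mixed discriminant: column operations replace the
monomials by the polynomials `p n`. -/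
lemma weightProduct_eq_mixedDiscriminant {p : ℕ → ℝ[X]} (hp : ∀ n, (p n).natDegree ≤ n)
    (w : ℝ → ℝ) (N : ℕ) (x : Fin N → ℝ) :
    (Matrix.of fun i j : Fin N => (p j).coeff i).det ^ 2 * weightProduct w N x =
      mixedDiscriminant fun i => pointMatrix w p N (x i) := by
  have h1 : ∏ j : Fin N, ∏ k ∈ Ioi j, |x k - x j| ^ 2 = (Matrix.vandermonde x).det ^ 2 := by
    simp_rw [Matrix.det_vandermonde, sq_abs, Finset.prod_pow]
  have h2 : (Matrix.of fun i j : Fin N => (p j).eval (x i)).det =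
      (Matrix.vandermonde x).det * (Matrix.of fun i j : Fin N => (p j).coeff i).det := by
    rw [Matrix.eval_matrixOfPolynomials_eq_vandermonde_mul_matrixOfPolynomials x
      (fun j : Fin N => p j) fun i => hp i, Matrix.det_mul]
  rw [weightProduct, h1]
  calc _ = (∏ l, w (x l)) * ((Matrix.of fun i j : Fin N => (p j).eval (x i)).det *
          (Matrix.of fun i j : Fin N => (p j).eval (x i)).det) := by rw [h2]; ring
    _ = _ := by
      rw [← Matrix.det_transpose, Matrix.det_apply', Finset.sum_mul_sum, Finset.mul_sum]
      refine Finset.sum_congr rfl fun σ _ => ?_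
      rw [Finset.mul_sum]
      refine Finset.sum_congr rfl fun τ _ => ?_
      simp only [Matrix.transpose_apply, Matrix.of_apply, pointMatrix, Finset.prod_mul_distrib]
      ring

lemma prod_joinCoords {N m : ℕ} (hm : m ≤ N) {M : Type*} [CommMonoid M] (G : Fin N → ℝ → M)
    (x : Fin m → ℝ) (y : Fin (N - m) → ℝ) :
    ∏ i, G i (joinCoords x y i) = (∏ i : Fin m, G (Fin.castLE hm i) (x i)) *
      ∏ j : Fin (N - m), G ⟨m + j, by omega⟩ (y j) := by
  rw [← Equiv.prod_comp (finSumFinEquiv.trans (finCongr (show m + (N - m) = N by omega))),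
    Fintype.prod_sum_type]
  congr 1
  · refine Finset.prod_congr rfl fun i _ => ?_
    simp [joinCoords]
    rfl
  · refine Finset.prod_congr rfl fun j _ => ?_
    simp [joinCoords]
    rfl

lemma integrable_prod_joinCoords {N m : ℕ} (hm : m ≤ N) {G : Fin N → ℝ → ℝ}
    (hG : ∀ i, Integrable (G i)) (x : Fin m → ℝ) :
    Integrable fun y : Fin (N - m) → ℝ => ∏ i, G i (joinCoords x y i) := by
  simp_rw [prod_joinCoords hm]
  refine Integrable.const_mul ?_ _
  exact Integrable.fintype_prod (f := fun (j : Fin (N - m)) t => G ⟨m + j, by omega⟩ t)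
    fun j => hG _

lemma integral_prod_joinCoords {N m : ℕ} (hm : m ≤ N) (G : Fin N → ℝ → ℝ) (x : Fin m → ℝ) :
    ∫ y : Fin (N - m) → ℝ, ∏ i, G i (joinCoords x y i) =
      ∏ i : Fin N, if h : (i : ℕ) < m then G i (x ⟨i, h⟩) else ∫ t, G i t := by
  simp_rw [prod_joinCoords hm]
  rw [integral_const_mul,
    integral_fintype_prod_volume_eq_prod fun (j : Fin (N - m)) t => G ⟨m + j, by omega⟩ t]
  rw [← Equiv.prod_comp (finSumFinEquiv.trans (finCongr (show m + (N - m) = N by omega))),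
    Fintype.prod_sum_type]
  congr 1
  · refine Finset.prod_congr rfl fun i _ => ?_
    simp
    rfl
  · refine Finset.prod_congr rfl fun j _ => ?_
    simp
    rfl

lemma integral_mixedDiscriminant {N : ℕ} {A : Fin N → ℝ → Matrix (Fin N) (Fin N) ℂ}
    (hA : ∀ i m n, Integrable fun t => A i t m n) :
    ∫ x : Fin N → ℝ, mixedDiscriminant (fun i => A i (x i)) =
      mixedDiscriminant fun i => Matrix.of fun m n => ∫ t, A i t m n := by
  have hint : ∀ σ τ : Equiv.Perm (Fin N), Integrable fun x : Fin N → ℝ =>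
      ∏ i, A i (x i) (σ i) (τ i) := fun σ τ =>
    Integrable.fintype_prod (f := fun (i : Fin N) t => A i t (σ i) (τ i)) fun i => hA _ _ _
  unfold mixedDiscriminant
  rw [integral_finsetSum _ fun σ _ => integrable_finsetSum _ fun τ _ => (hint σ τ).const_mul _]
  refine Finset.sum_congr rfl fun σ _ => ?_
  rw [integral_finsetSum _ fun τ _ => (hint σ τ).const_mul _]
  refine Finset.sum_congr rfl fun τ _ => ?_
  rw [integral_const_mul,
    integral_fintype_prod_volume_eq_prod fun (i : Fin N) t => A i t (σ i) (τ i)]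
  rfl

namespace IsOrthonormal

variable {w : ℝ → ℝ} {p : ℕ → ℝ[X]}

lemma integrable_pointMatrix (hp : IsOrthonormal w p) {N : ℕ} (m n : Fin N) :
    Integrable fun t => pointMatrix w p N t m n := by
  simpa [pointMatrix] using hp.integrable (p m * p n)

lemma integral_pointMatrix (hp : IsOrthonormal w p) {N : ℕ} (m n : Fin N) :
    ∫ t, pointMatrix w p N t m n = (1 : Matrix (Fin N) (Fin N) ℝ) m n := by
  simp [pointMatrix, hp.integral_eq, Matrix.one_apply, Fin.ext_iff]

lemma integral_mixedDiscriminant_joinCoords (hp : IsOrthonormal w p) {N m : ℕ} (hm : m ≤ N)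
    (x : Fin m → ℝ) :
    ∫ y : Fin (N - m) → ℝ, mixedDiscriminant (fun i => pointMatrix w p N (joinCoords x y i)) =
      mixedDiscriminant fun i : Fin N =>
        if h : (i : ℕ) < m then pointMatrix w p N (x ⟨i, h⟩) else 1 := by
  have hint : ∀ σ τ : Equiv.Perm (Fin N), Integrable fun y : Fin (N - m) → ℝ =>
      ∏ i, pointMatrix w p N (joinCoords x y i) (σ i) (τ i) := fun σ τ =>
    integrable_prod_joinCoords hm (G := fun i t => pointMatrix w p N t (σ i) (τ i))
      (fun i => hp.integrable_pointMatrix _ _) x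
  unfold mixedDiscriminant
  rw [integral_finsetSum _ fun σ _ => integrable_finsetSum _ fun τ _ => (hint σ τ).const_mul _]
  refine Finset.sum_congr rfl fun σ _ => ?_
  rw [integral_finsetSum _ fun τ _ => (hint σ τ).const_mul _]
  refine Finset.sum_congr rfl fun τ _ => ?_
  rw [integral_const_mul,
    integral_prod_joinCoords hm fun i t => pointMatrix w p N t (σ i) (τ i)]
  congr 1
  refine Finset.prod_congr rfl fun i _ => ?_
  by_cases h : (i : ℕ) < m
  · simp only [h, dite_true]
  · simp only [h, dite_false]
    exact hp.integral_pointMatrix _ _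

lemma integral_mixedDiscriminant_pointMatrix (hp : IsOrthonormal w p) (N : ℕ) :
    ∫ x : Fin N → ℝ, mixedDiscriminant (fun i => pointMatrix w p N (x i)) = N.factorial := by
  have h := hp.integral_mixedDiscriminant_joinCoords (Nat.zero_le N) Fin.elim0
  simpa [joinCoords, mixedDiscriminant_one] using h

/-- The joint density is a mixed discriminant of rank-one matrices, one for each eigenvalue. -/
lemma jointDensity_eq (hp : IsOrthonormal w p) (N : ℕ) (x : Fin N → ℝ) :
    jointDensity w N x =
      (N.factorial : ℝ)⁻¹ * mixedDiscriminant fun i => pointMatrix w p N (x i) := by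
  have hN : (N.factorial : ℝ) ≠ 0 := by positivity
  -- by `h2`, neither the determinant of the coefficients nor the normalisation vanishes
  have h1 := weightProduct_eq_mixedDiscriminant hp.natDegree_le w N
  have h2 : (Matrix.of fun i j : Fin N => (p j).coeff i).det ^ 2 * normalization w N =
      N.factorial := by
    rw [normalization, ← integral_const_mul, integral_congr_ae (ae_of_all _ h1),
      hp.integral_mixedDiscriminant_pointMatrix]
  rw [jointDensity, ← h1, ← h2]
  generalize (Matrix.of fun i j : Fin N => (p j).coeff i).det ^ 2 = c at *
  have hc : c ≠ 0 := fun h => hN (by rw [← h2, h, zero_mul])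
  have hZ : normalization w N ≠ 0 := fun h => hN (by rw [← h2, h, mul_zero])
  field_simp

lemma correlation_eq (hp : IsOrthonormal w p) {N m : ℕ} (hm : m ≤ N) (x : Fin m → ℝ) :
    correlation w N m x = (N.descFactorial m : ℝ) * ((N.factorial : ℝ)⁻¹ *
      mixedDiscriminant fun i : Fin N =>
        if h : (i : ℕ) < m then pointMatrix w p N (x ⟨i, h⟩) else 1) := by
  simp_rw [correlation, hp.jointDensity_eq]
  rw [integral_const_mul, hp.integral_mixedDiscriminant_joinCoords hm]

end IsOrthonormal

/-- The correlation kernel `K(x, y) = ∑_{n < N} p n x * p n y`, without the weight factors. -/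
noncomputable def kernel (p : ℕ → ℝ[X]) (N : ℕ) (x y : ℝ) : ℝ :=
  ∑ n ∈ range N, (p n).eval x * (p n).eval y

namespace IsOrthonormal

variable {w : ℝ → ℝ} {p : ℕ → ℝ[X]}

lemma eigenvalueDensity_eq (hp : IsOrthonormal w p) (N : ℕ) (x : ℝ) :
    eigenvalueDensity w N x = w x * kernel p N x x := by
  rcases Nat.eq_zero_or_pos N with rfl | hN
  · simp [eigenvalueDensity, correlation, kernel]
  have hN' : (N.factorial : ℝ) ≠ 0 := by positivity
  have h := card_mul_sum_perm_apply (⟨0, hN⟩ : Fin N) fun n => pointMatrix w p N x n n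
  rw [eigenvalueDensity, hp.correlation_eq hN, mixedDiscriminant_eq_of_forall_ne (j := ⟨0, hN⟩)]
  · simp only [Fintype.card_fin] at h
    simp only [Nat.descFactorial_one, Nat.lt_one_iff, dite_true, Matrix.cons_val_fin_one]
    rw [mul_left_comm, h, ← mul_assoc, inv_mul_cancel₀ hN', one_mul, kernel, Finset.mul_sum,
      ← Fin.sum_univ_eq_sum_range fun n => w x * ((p n).eval x * (p n).eval x)]
    rfl
  · intro i hi
    have : (i : ℕ) ≠ 0 := fun h => hi (Fin.ext h)
    simp [this]

lemma truncatedTwoPoint_eq (hp : IsOrthonormal w p) (N : ℕ) (x y : ℝ) :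
    truncatedTwoPoint w N x y = -(w x * w y * kernel p N x y ^ 2) := by
  have hK : ∑ m : Fin N, ∑ n : Fin N, (pointMatrix w p N x m m * pointMatrix w p N y n n -
      pointMatrix w p N x m n * pointMatrix w p N y n m) =
      w x * kernel p N x x * (w y * kernel p N y y) - w x * w y * kernel p N x y ^ 2 := by
    simp only [pointMatrix, Matrix.of_apply, Finset.sum_sub_distrib, kernel, sq,
      ← Fin.sum_univ_eq_sum_range (fun n => (p n).eval _ * (p n).eval _), Finset.mul_sum,
      Finset.sum_mul]
    congr 1
    · rw [Finset.sum_comm]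
    · refine Finset.sum_congr rfl fun m _ => Finset.sum_congr rfl fun n _ => ?_
      ring
  rw [truncatedTwoPoint, hp.eigenvalueDensity_eq, hp.eigenvalueDensity_eq]
  rcases lt_or_ge N 2 with hN | hN
  -- for `N < 2` there is no two-point function, and `K(x, x) K(y, y) = K(x, y) ^ 2`
  · have : correlation w N 2 ![x, y] = 0 := by
      rw [correlation, Nat.descFactorial_of_lt hN]; simp
    rw [this]
    interval_cases N <;> simp [kernel]; ring
  have hN' : (N.factorial : ℝ) ≠ 0 := by positivity
  have h01 : (⟨0, by omega⟩ : Fin N) ≠ ⟨1, by omega⟩ := by simp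
  have h := card_mul_sum_perm_apply_apply h01 (fun m n =>
    pointMatrix w p N x m m * pointMatrix w p N y n n -
      pointMatrix w p N x m n * pointMatrix w p N y n m) (fun m => sub_self _)
  rw [hp.correlation_eq hN, mixedDiscriminant_eq_of_forall_ne_ne h01]
  · simp only [Fintype.card_fin, hK] at h
    have hd : (N.descFactorial 2 : ℝ) = N * (N - 1) := by
      rw [Nat.descFactorial_succ, Nat.descFactorial_one]
      push_cast [Nat.cast_sub (show 1 ≤ N by omega)]
      ring
    rw [mul_left_comm, hd]
    simp only [Nat.ofNat_pos, Nat.one_lt_ofNat, dite_true]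
    have h' := congrArg (fun s => (N.factorial : ℝ)⁻¹ * s) h
    rw [inv_mul_cancel_left₀ hN'] at h'
    refine (sub_eq_iff_eq_add.2 ?_)
    rw [neg_add_eq_sub]
    exact h'
  · intro i hi hi'
    have h0 : (i : ℕ) ≠ 0 := fun h => hi (Fin.ext h)
    have h1 : (i : ℕ) ≠ 1 := fun h => hi' (Fin.ext h)
    rw [dif_neg (by omega)]

end IsOrthonormal

/-! ### Fourier statistics of unitary ensembles -/

/-- The matrix element `∫ exp (i k x) * p m x * p n x * w x dx` of multiplication by `exp (i k x)`
in the basis `p`. -/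
noncomputable def expMoment (w : ℝ → ℝ) (p : ℕ → ℝ[X]) (k : ℝ) (m n : ℕ) : ℂ :=
  ∫ x : ℝ, Complex.exp (Complex.I * k * x) * ((w x * ((p m).eval x * (p n).eval x) : ℝ) : ℂ)

lemma norm_exp_I_mul_mul (k x : ℝ) : ‖Complex.exp (Complex.I * k * x)‖ = 1 := by
  rw [Complex.norm_exp]; simp

lemma conj_exp_I_mul_mul (k x : ℝ) :
    (starRingEnd ℂ) (Complex.exp (Complex.I * k * x)) = Complex.exp (Complex.I * (-k : ℝ) * x) := by
  rw [← Complex.exp_conj]; simp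

lemma exp_I_mul_mul_mul_neg (k x : ℝ) :
    Complex.exp (Complex.I * k * x) * Complex.exp (Complex.I * (-k : ℝ) * x) = 1 := by
  rw [← Complex.exp_add]; simp

lemma expMoment_comm (w : ℝ → ℝ) (p : ℕ → ℝ[X]) (k : ℝ) (m n : ℕ) :
    expMoment w p k m n = expMoment w p k n m := by
  simp only [expMoment, mul_comm ((p m).eval _)]

lemma expMoment_neg (w : ℝ → ℝ) (p : ℕ → ℝ[X]) (k : ℝ) (m n : ℕ) :
    expMoment w p (-k) m n = (starRingEnd ℂ) (expMoment w p k m n) := by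
  rw [expMoment, expMoment, ← integral_conj]
  simp only [map_mul, conj_exp_I_mul_mul, Complex.conj_ofReal]

lemma ofReal_norm_expSum_sq (N : ℕ) (k : ℝ) (x : Fin N → ℝ) :
    ((‖expSum N k x‖ ^ 2 : ℝ) : ℂ) = ∑ j, ∑ l,
      Complex.exp (Complex.I * k * x j) * Complex.exp (Complex.I * (-k : ℝ) * x l) := by
  rw [Complex.ofReal_pow, ← Complex.mul_conj', expSum, map_sum, Finset.sum_mul_sum]
  simp only [conj_exp_I_mul_mul]

namespace IsOrthonormal

variable {w : ℝ → ℝ} {p : ℕ → ℝ[X]}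

lemma integrable_exp_mul (hp : IsOrthonormal w p) (k : ℝ) (m n : ℕ) :
    Integrable fun x : ℝ => Complex.exp (Complex.I * k * x) *
      ((w x * ((p m).eval x * (p n).eval x) : ℝ) : ℂ) := by
  have h := (hp.integrable (p m * p n)).ofReal (𝕜 := ℂ)
  simp only [Polynomial.eval_mul] at h
  exact h.bdd_mul (c := 1) (by fun_prop) (ae_of_all _ fun x => (norm_exp_I_mul_mul k x).le)

lemma integrable_jointDensity (hp : IsOrthonormal w p) (N : ℕ) :
    Integrable fun x : Fin N → ℝ => jointDensity w N x := by
  simp_rw [hp.jointDensity_eq, mixedDiscriminant]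
  refine (integrable_finsetSum _ fun σ _ => integrable_finsetSum _ fun τ _ =>
    Integrable.const_mul ?_ _).const_mul _
  exact Integrable.fintype_prod (f := fun (i : Fin N) t => pointMatrix w p N t (σ i) (τ i))
    fun i => hp.integrable_pointMatrix _ _

/-- The average of a product of functions of the separate eigenvalues is a mixed discriminant. -/
lemma average_prod (hp : IsOrthonormal w p) (N : ℕ) {f : Fin N → ℝ → ℂ}
    (hf : ∀ (i m n : Fin N), Integrable fun t =>
      f i t * ((w t * ((p m).eval t * (p n).eval t) : ℝ) : ℂ)) :
    average w N (fun x => ∏ i, f i (x i)) = (N.factorial : ℂ)⁻¹ *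
      mixedDiscriminant fun i => Matrix.of fun m n : Fin N =>
        ∫ t, f i t * ((w t * ((p m).eval t * (p n).eval t) : ℝ) : ℂ) := by
  have h := integral_mixedDiscriminant (A := fun i t => Matrix.of fun m n : Fin N =>
    f i t * ((w t * ((p m).eval t * (p n).eval t) : ℝ) : ℂ)) hf
  simp only [Matrix.of_apply] at h
  rw [← h, average, ← integral_const_mul]
  refine integral_congr_ae (ae_of_all _ fun x => ?_)
  simp only [hp.jointDensity_eq, Complex.real_smul, Complex.ofReal_mul, Complex.ofReal_inv,
    Complex.ofReal_natCast, mul_assoc]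
  congr 1
  rw [mixedDiscriminant, mixedDiscriminant, Complex.ofReal_sum, Finset.sum_mul]
  refine Finset.sum_congr rfl fun σ _ => ?_
  rw [Complex.ofReal_sum, Finset.sum_mul]
  refine Finset.sum_congr rfl fun τ _ => ?_
  simp only [pointMatrix, Matrix.of_apply, Finset.prod_mul_distrib, Complex.ofReal_mul,
    Complex.ofReal_prod, Complex.ofReal_intCast]
  ring

lemma integral_one_mul (hp : IsOrthonormal w p) {N : ℕ} :
    (Matrix.of fun m n : Fin N => ∫ t, (1 : ℂ) * ((w t * ((p m).eval t * (p n).eval t) : ℝ) : ℂ)) =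
      1 := by
  ext m n
  simp only [one_mul, Matrix.of_apply, integral_complex_ofReal, hp.integral_eq, Matrix.one_apply,
    Fin.ext_iff]
  split_ifs <;> simp

lemma average_one (hp : IsOrthonormal w p) (N : ℕ) : average w N (fun _ => (1 : ℂ)) = 1 := by
  have h := hp.average_prod N (f := fun _ _ => 1) (fun i m n => by
    simpa using (hp.integrable (p m * p n)).ofReal (𝕜 := ℂ))
  have hN : (N.factorial : ℂ) ≠ 0 := by exact_mod_cast N.factorial_ne_zero
  simp only [Finset.prod_const_one, hp.integral_one_mul, mixedDiscriminant_one, Fintype.card_fin,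
    inv_mul_cancel₀ hN] at h
  exact h

lemma average_exp (hp : IsOrthonormal w p) (N : ℕ) (k : ℝ) (j : Fin N) :
    average w N (fun x => Complex.exp (Complex.I * k * x j)) = (N.factorial : ℂ)⁻¹ *
      ∑ σ : Equiv.Perm (Fin N), expMoment w p k (σ j) (σ j) := by
  have h := hp.average_prod N (f := fun i t =>
      if i = j then Complex.exp (Complex.I * k * t) else 1) (fun i m n => by
    by_cases hi : i = j
    · simpa only [hi, if_true] using hp.integrable_exp_mul k m n
    · simpa [hi] using (hp.integrable (p m * p n)).ofReal (𝕜 := ℂ))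
  simp only [Finset.prod_ite_eq', Finset.mem_univ, if_true] at h
  rw [h, mixedDiscriminant_eq_of_forall_ne (j := j)]
  · simp [expMoment]
  · intro i hi
    simpa only [hi, if_false] using hp.integral_one_mul

lemma average_exp_mul_exp (hp : IsOrthonormal w p) (N : ℕ) (k : ℝ) {j l : Fin N} (hjl : j ≠ l) :
    average w N (fun x => Complex.exp (Complex.I * k * x j) *
        Complex.exp (Complex.I * (-k : ℝ) * x l)) = (N.factorial : ℂ)⁻¹ *
      ∑ σ : Equiv.Perm (Fin N), (expMoment w p k (σ j) (σ j) * expMoment w p (-k) (σ l) (σ l) -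
        expMoment w p k (σ j) (σ l) * expMoment w p (-k) (σ l) (σ j)) := by
  have h := hp.average_prod N (f := fun i t =>
      if i = j then Complex.exp (Complex.I * k * t) else
        if i = l then Complex.exp (Complex.I * (-k : ℝ) * t) else 1) (fun i m n => by
    by_cases hi : i = j
    · simpa only [hi, if_true] using hp.integrable_exp_mul k m n
    by_cases hi' : i = l
    · simpa only [hi', hjl.symm, if_false, if_true] using hp.integrable_exp_mul (-k) m n
    · simpa [hi, hi'] using (hp.integrable (p m * p n)).ofReal (𝕜 := ℂ))
  have hprod : ∀ x : Fin N → ℝ, (∏ i, if i = j then Complex.exp (Complex.I * k * x i) else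
        if i = l then Complex.exp (Complex.I * (-k : ℝ) * x i) else 1) =
      Complex.exp (Complex.I * k * x j) * Complex.exp (Complex.I * (-k : ℝ) * x l) := by
    intro x
    rw [← Finset.prod_subset (Finset.subset_univ {j, l}), Finset.prod_pair hjl]
    · simp [hjl.symm]
    · intro i _ hi
      simp only [Finset.mem_insert, Finset.mem_singleton, not_or] at hi
      simp [hi.1, hi.2]
  simp only [hprod] at h
  rw [h, mixedDiscriminant_eq_of_forall_ne_ne hjl]
  · simp [expMoment, hjl.symm]
  · intro i hi hi'
    simpa only [hi, hi', if_false] using hp.integral_one_mul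

lemma integrable_jointDensity_smul (hp : IsOrthonormal w p) (N : ℕ) {f : (Fin N → ℝ) → ℂ}
    (hf : Continuous f) (hb : ∀ x, ‖f x‖ ≤ 1) :
    Integrable fun x : Fin N → ℝ => jointDensity w N x • f x := by
  have := (hp.integrable_jointDensity N).ofReal (𝕜 := ℂ)
  simp_rw [Complex.real_smul]
  exact this.mul_bdd (c := 1) hf.aestronglyMeasurable (ae_of_all _ hb)

lemma average_expSum (hp : IsOrthonormal w p) (N : ℕ) (k : ℝ) :
    average w N (expSum N k) = ∑ n : Fin N, expMoment w p k n n := by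
  have hN : (N.factorial : ℂ) ≠ 0 := by exact_mod_cast N.factorial_ne_zero
  have h1 : average w N (expSum N k) =
      ∑ j, average w N (fun x => Complex.exp (Complex.I * k * x j)) := by
    simp only [average, expSum, Finset.smul_sum]
    exact integral_finsetSum _ fun j _ => hp.integrable_jointDensity_smul N (by fun_prop)
      fun x => (norm_exp_I_mul_mul k (x j)).le
  rw [h1]
  simp_rw [hp.average_exp]
  rw [← Finset.mul_sum, sum_perm_sum_apply (fun n : Fin N => expMoment w p k n n),
    Fintype.card_fin, inv_mul_cancel_left₀ hN]

lemma average_norm_expSum_sq (hp : IsOrthonormal w p) (N : ℕ) (k : ℝ) :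
    ((average w N (fun x => ‖expSum N k x‖ ^ 2) : ℝ) : ℂ) = N + ∑ m : Fin N, ∑ n : Fin N,
      (expMoment w p k m m * expMoment w p (-k) n n -
        expMoment w p k m n * expMoment w p (-k) n m) := by
  have hN : (N.factorial : ℂ) ≠ 0 := by exact_mod_cast N.factorial_ne_zero
  have h1 : ((average w N (fun x => ‖expSum N k x‖ ^ 2) : ℝ) : ℂ) = ∑ j, ∑ l,
      average w N (fun x => Complex.exp (Complex.I * k * x j) *
        Complex.exp (Complex.I * (-k : ℝ) * x l)) := by
    have hint : ∀ j l : Fin N, Integrable fun x : Fin N → ℝ => jointDensity w N x •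
        (Complex.exp (Complex.I * k * x j) * Complex.exp (Complex.I * (-k : ℝ) * x l)) :=
      fun j l => hp.integrable_jointDensity_smul N (by fun_prop) fun x => by
        rw [norm_mul, norm_exp_I_mul_mul, norm_exp_I_mul_mul, one_mul]
    rw [average, ← integral_complex_ofReal]
    simp only [smul_eq_mul, Complex.ofReal_mul _ (‖_‖ ^ 2), ofReal_norm_expSum_sq, average]
    simp only [← Complex.real_smul, Finset.smul_sum]
    rw [integral_finsetSum _ fun j _ => integrable_finsetSum _ fun l _ => hint j l]
    exact Finset.sum_congr rfl fun j _ => integral_finsetSum _ fun l _ => hint j l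
  have h2 : ∀ j l : Fin N, average w N (fun x => Complex.exp (Complex.I * k * x j) *
        Complex.exp (Complex.I * (-k : ℝ) * x l)) =
      (if j = l then 1 else 0) + (N.factorial : ℂ)⁻¹ *
      ∑ σ : Equiv.Perm (Fin N), (expMoment w p k (σ j) (σ j) * expMoment w p (-k) (σ l) (σ l) -
        expMoment w p k (σ j) (σ l) * expMoment w p (-k) (σ l) (σ j)) := by
    intro j l
    split_ifs with h
    · subst h
      simp only [exp_I_mul_mul_mul_neg, hp.average_one, sub_self, Finset.sum_const_zero, mul_zero,
        add_zero]
    · rw [zero_add, hp.average_exp_mul_exp N k h]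
  rw [h1]
  simp_rw [h2, Finset.sum_add_distrib, ← Finset.mul_sum]
  rw [sum_perm_sum_apply_apply (fun m n : Fin N => expMoment w p k m m * expMoment w p (-k) n n -
        expMoment w p k m n * expMoment w p (-k) n m), Fintype.card_fin, inv_mul_cancel_left₀ hN]
  simp

theorem structureFunction_eq (hp : IsOrthonormal w p) (N : ℕ) (k : ℝ) :
    structureFunction w N k =
      N - ∑ m ∈ range N, ∑ n ∈ range N, ‖expMoment w p k m n‖ ^ 2 := by
  apply Complex.ofReal_injective
  simp only [structureFunction, Complex.ofReal_sub, hp.average_norm_expSum_sq, hp.average_expSum,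
    Complex.ofReal_pow, ← Complex.mul_conj', Complex.ofReal_sum, Finset.sum_range,
    Complex.ofReal_natCast, map_sum, expMoment_neg, Finset.sum_mul_sum, Finset.sum_sub_distrib]
  rw [add_sub_assoc, sub_sub_cancel_left, ← sub_eq_add_neg]
  congr 1
  exact Finset.sum_congr rfl fun m _ => Finset.sum_congr rfl fun n _ => by
    rw [expMoment_comm w p k n m]

lemma exp_mul_truncatedTwoPoint (hp : IsOrthonormal w p) (N : ℕ) (k x y : ℝ) :
    Complex.exp (Complex.I * k * (x - y)) * (truncatedTwoPoint w N x y : ℂ) =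
      -∑ m ∈ range N, ∑ n ∈ range N,
        (Complex.exp (Complex.I * k * x) * ((w x * ((p m).eval x * (p n).eval x) : ℝ) : ℂ)) *
        (Complex.exp (Complex.I * (-k : ℝ) * y) *
          ((w y * ((p m).eval y * (p n).eval y) : ℝ) : ℂ)) := by
  have h : Complex.exp (Complex.I * k * (x - y)) =
      Complex.exp (Complex.I * k * x) * Complex.exp (Complex.I * (-k : ℝ) * y) := by
    rw [← Complex.exp_add]; congr 1; push_cast; ring
  rw [hp.truncatedTwoPoint_eq, h, kernel, sq, Finset.sum_mul_sum]
  push_cast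
  rw [mul_neg, Finset.mul_sum, Finset.mul_sum]
  congr 1
  refine Finset.sum_congr rfl fun m _ => ?_
  rw [Finset.mul_sum, Finset.mul_sum]
  refine Finset.sum_congr rfl fun n _ => ?_
  ring

theorem integrable_exp_mul_truncatedTwoPoint (hp : IsOrthonormal w p) (N : ℕ) (k : ℝ) :
    Integrable fun z : ℝ × ℝ =>
      Complex.exp (Complex.I * k * (z.1 - z.2)) * (truncatedTwoPoint w N z.1 z.2 : ℂ) := by
  simp only [hp.exp_mul_truncatedTwoPoint]
  exact (integrable_finsetSum _ fun m _ => integrable_finsetSum _ fun n _ =>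
    (hp.integrable_exp_mul k m n).mul_prod (hp.integrable_exp_mul (-k) m n)).neg

theorem integral_exp_mul_truncatedTwoPoint (hp : IsOrthonormal w p) (N : ℕ) (k : ℝ) :
    ∫ z : ℝ × ℝ, Complex.exp (Complex.I * k * (z.1 - z.2)) *
        (truncatedTwoPoint w N z.1 z.2 : ℂ) =
      -((∑ m ∈ range N, ∑ n ∈ range N, ‖expMoment w p k m n‖ ^ 2 : ℝ) : ℂ) := by
  have hint := fun m n => (hp.integrable_exp_mul k m n).mul_prod (hp.integrable_exp_mul (-k) m n)
  simp only [hp.exp_mul_truncatedTwoPoint]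
  rw [integral_neg, Measure.volume_eq_prod]
  rw [integral_finsetSum _ fun m _ => integrable_finsetSum _ fun n _ => hint m n]
  simp only [Complex.ofReal_sum]
  congr 1
  refine Finset.sum_congr rfl fun m _ => ?_
  rw [integral_finsetSum _ fun n _ => hint m n]
  refine Finset.sum_congr rfl fun n _ => ?_
  rw [Complex.ofReal_pow, ← Complex.mul_conj', ← expMoment_neg]
  exact integral_prod_mul (μ := volume) (ν := volume)
    (fun x : ℝ => Complex.exp (Complex.I * k * x) * ((w x * ((p m).eval x * (p n).eval x) : ℝ) : ℂ))
    (fun y : ℝ => Complex.exp (Complex.I * (-k : ℝ) * y) *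
          ((w y * ((p m).eval y * (p n).eval y) : ℝ) : ℂ))

end IsOrthonormal

/-! ### Laguerre polynomials -/

section Laguerre

variable {𝕂 : Type*} [Field 𝕂]

lemma eval_ascPochhammer_add (s : 𝕂) (j i : ℕ) :
    (ascPochhammer 𝕂 (j + i)).eval s =
      (ascPochhammer 𝕂 j).eval s * (ascPochhammer 𝕂 i).eval (s + j) := by
  rw [← ascPochhammer_mul]; simp

lemma eval_ascPochhammer_ne_zero {s : 𝕂} (hs : ∀ n : ℕ, s + n ≠ 0) (n : ℕ) :
    (ascPochhammer 𝕂 n).eval s ≠ 0 := by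
  induction n with
  | zero => simp
  | succ n ih => rw [ascPochhammer_succ_eval]; exact mul_ne_zero ih (hs n)

/-- The linear functional `X ^ j ↦ s (s + 1) ⋯ (s + j - 1)` on polynomials: up to the factor
`Γ s`, integration against `x ^ (s - 1) * exp (-x)` on the half-line. -/
noncomputable def gammaFunctional (s : 𝕂) : 𝕂[X] →ₗ[𝕂] 𝕂 :=
  (Polynomial.basisMonomials 𝕂).constr 𝕂 fun j => (ascPochhammer 𝕂 j).eval s

/-- The linear map `X ^ j ↦ X ^ j / (s (s + 1) ⋯ (s + j - 1))`. It commutes with `X * derivative`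
and with scaling of `X`, which transfers identities between powers of `1 - X` to Laguerre
polynomials. -/
noncomputable def umbralMap (s : 𝕂) : 𝕂[X] →ₗ[𝕂] 𝕂[X] :=
  (Polynomial.basisMonomials 𝕂).constr 𝕂 fun j => monomial j ((ascPochhammer 𝕂 j).eval s)⁻¹

/-- The Laguerre polynomial with parameter `s - 1` normalised to have constant term `1`, which is
`∑ j, (-1) ^ j * choose n j * X ^ j / (s (s + 1) ⋯ (s + j - 1))`. -/
noncomputable def laguerre (s : 𝕂) (n : ℕ) : 𝕂[X] :=
  umbralMap s ((1 - X) ^ n)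

/-- The squared norm of `laguerre s n` for `gammaFunctional s`. -/
noncomputable def laguerreNorm (s : 𝕂) (n : ℕ) : 𝕂 :=
  n.factorial / (ascPochhammer 𝕂 n).eval s

lemma gammaFunctional_monomial (s : 𝕂) (j : ℕ) (c : 𝕂) :
    gammaFunctional s (monomial j c) = c * (ascPochhammer 𝕂 j).eval s := by
  have h : monomial j c = c • Polynomial.basisMonomials 𝕂 j := by
    simp [smul_monomial]
  rw [gammaFunctional, h, map_smul, Module.Basis.constr_basis, smul_eq_mul]

lemma umbralMap_monomial (s : 𝕂) (j : ℕ) (c : 𝕂) :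
    umbralMap s (monomial j c) = monomial j (c / (ascPochhammer 𝕂 j).eval s) := by
  have h : monomial j c = c • Polynomial.basisMonomials 𝕂 j := by
    simp [smul_monomial]
  rw [umbralMap, h, map_smul, Module.Basis.constr_basis, smul_monomial, smul_eq_mul,
    div_eq_mul_inv]

lemma coeff_umbralMap (s : 𝕂) (q : 𝕂[X]) (j : ℕ) :
    (umbralMap s q).coeff j = q.coeff j / (ascPochhammer 𝕂 j).eval s := by
  induction q using Polynomial.induction_on' with
  | add p q hp hq => rw [map_add, coeff_add, hp, hq, coeff_add, add_div]
  | monomial i c =>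
    rw [umbralMap_monomial, coeff_monomial, coeff_monomial]
    split_ifs with h
    · rw [h]
    · simp

lemma X_mul_derivative_umbralMap (s : 𝕂) (q : 𝕂[X]) :
    X * derivative (umbralMap s q) = umbralMap s (X * derivative q) := by
  ext (_ | j)
  · simp [coeff_umbralMap]
  · simp only [coeff_umbralMap, coeff_X_mul, coeff_derivative]
    ring

lemma X_mul_umbralMap {s : 𝕂} (hs : ∀ n : ℕ, s + n ≠ 0) (q : 𝕂[X]) :
    X * umbralMap s q = umbralMap s (X * (C s * q + X * derivative q)) := by
  ext (_ | j)
  · simp [coeff_umbralMap]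
  · have h1 := eval_ascPochhammer_ne_zero hs j
    have h2 := hs j
    simp only [coeff_umbralMap, coeff_X_mul, coeff_add, coeff_C_mul, ascPochhammer_succ_eval]
    have h3 : (X * derivative q).coeff j = j * q.coeff j := by
      cases j with
      | zero => simp
      | succ j => simp [coeff_derivative, mul_comm]
    rw [h3]
    field_simp

lemma umbralMap_comp (s c : 𝕂) (q : 𝕂[X]) :
    (umbralMap s q).comp (C c * X) = umbralMap s (q.comp (C c * X)) := by
  ext j
  simp only [coeff_umbralMap, comp_C_mul_X_coeff]
  ring

lemma coeff_laguerre (s : 𝕂) (n j : ℕ) :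
    (laguerre s n).coeff j = (-1) ^ j * n.choose j / (ascPochhammer 𝕂 j).eval s := by
  have h : ((1 - X : 𝕂[X]) ^ n).coeff j = (-1) ^ j * n.choose j := by
    have : (1 - X : 𝕂[X]) ^ n = ((1 + X) ^ n).comp (C (-1) * X) := by simp [sub_eq_add_neg]
    rw [this, comp_C_mul_X_coeff, coeff_one_add_X_pow, mul_comm]
  rw [laguerre, coeff_umbralMap, h]

lemma natDegree_laguerre_le (s : 𝕂) (n : ℕ) : (laguerre s n).natDegree ≤ n := by
  rw [natDegree_le_iff_coeff_eq_zero]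
  intro j hj
  simp [coeff_laguerre, Nat.choose_eq_zero_of_lt hj]

lemma laguerre_eq_sum (s : 𝕂) (n : ℕ) :
    laguerre s n = ∑ j ∈ range (n + 1),
      monomial j ((-1) ^ j * n.choose j / (ascPochhammer 𝕂 j).eval s) := by
  rw [(laguerre s n).as_sum_range' (n + 1) (Nat.lt_succ_of_le (natDegree_laguerre_le s n))]
  simp only [coeff_laguerre]

lemma map_laguerre {𝕃 : Type*} [Field 𝕃] (f : 𝕂 →+* 𝕃) (s : 𝕂) (n : ℕ) :
    (laguerre s n).map f = laguerre (f s) n := by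
  ext j
  rw [coeff_map, coeff_laguerre, coeff_laguerre]
  rw [← ascPochhammer_map f, eval_map_apply]
  simp

/-- The derivative formula for Laguerre polynomials. -/
lemma X_mul_derivative_laguerre (s : 𝕂) (n : ℕ) :
    X * derivative (laguerre s n) = C (n : 𝕂) * (laguerre s n - laguerre s (n - 1)) := by
  rw [laguerre, X_mul_derivative_umbralMap, laguerre, ← map_sub, ← smul_eq_C_mul, ← map_smul]
  congr 1
  cases n with
  | zero => simp
  | succ n =>
    rw [derivative_pow, smul_eq_C_mul]
    simp only [Nat.add_sub_cancel, derivative_sub, derivative_one, derivative_X, pow_succ]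
    ring

/-- The three-term recurrence for Laguerre polynomials. -/
lemma X_mul_laguerre {s : 𝕂} (hs : ∀ n : ℕ, s + n ≠ 0) (n : ℕ) :
    X * laguerre s n = C (2 * n + s) * laguerre s n - C (n + s) * laguerre s (n + 1) -
      C (n : 𝕂) * laguerre s (n - 1) := by
  simp only [laguerre]
  rw [X_mul_umbralMap hs]
  simp only [← smul_eq_C_mul, ← map_smul, ← map_sub]
  congr 1
  simp only [smul_eq_C_mul]
  cases n with
  | zero => simp; ring
  | succ n =>
    rw [derivative_pow]
    simp only [Nat.add_sub_cancel, derivative_sub, derivative_one, derivative_X, pow_succ]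
    simp only [map_add, map_mul, map_ofNat, map_natCast]
    push_cast
    ring

/-- The multiplication theorem for Laguerre polynomials: the image under `umbralMap` of the binomial
expansion of `(1 - c X) ^ n = (c (1 - X) + (1 - c)) ^ n`. -/
lemma laguerre_comp_C_mul_X (s c : 𝕂) (n : ℕ) :
    (laguerre s n).comp (C c * X) =
      ∑ j ∈ range (n + 1), C (n.choose j * (1 - c) ^ (n - j) * c ^ j) * laguerre s j := by
  have h : ((1 - X : 𝕂[X]) ^ n).comp (C c * X) =
      ∑ j ∈ range (n + 1), (n.choose j * (1 - c) ^ (n - j) * c ^ j) • (1 - X : 𝕂[X]) ^ j := by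
    have : ((1 - X : 𝕂[X]) ^ n).comp (C c * X) = (C c * (1 - X) + C (1 - c)) ^ n := by
      rw [pow_comp]; congr 1; simp; ring
    rw [this, add_pow]
    refine Finset.sum_congr rfl fun j _ => ?_
    rw [smul_eq_C_mul, mul_pow]
    simp only [map_mul, map_pow, map_natCast]
    ring
  rw [laguerre, umbralMap_comp, h, map_sum]
  simp only [map_smul]
  simp only [smul_eq_C_mul, laguerre]

lemma gammaFunctional_X_pow_mul_laguerre {s : 𝕂} (hs : ∀ n : ℕ, s + n ≠ 0) (i n : ℕ) :
    gammaFunctional s (X ^ i * laguerre s n) =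
      ∑ j ∈ range (n + 1), (-1) ^ j * n.choose j * (ascPochhammer 𝕂 i).eval (s + j) := by
  rw [laguerre_eq_sum, Finset.mul_sum, map_sum]
  refine Finset.sum_congr rfl fun j _ => ?_
  rw [X_pow_mul_monomial, gammaFunctional_monomial, eval_ascPochhammer_add]
  have := eval_ascPochhammer_ne_zero hs j
  field_simp

/-- The alternating binomial sum that yields orthogonality, both for Laguerre and for Jacobi
polynomials: an `n`-th finite difference of a polynomial of degree `i`. -/
lemma sum_choose_mul_ascPochhammer (s : 𝕂) (i n : ℕ) :
    ∑ j ∈ range (n + 1), (-1) ^ j * n.choose j * (ascPochhammer 𝕂 i).eval (s + j) =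
      (-1) ^ n * (fwdDiff (1 : 𝕂))^[n] (ascPochhammer 𝕂 i).eval s := by
  rw [fwdDiff_iter_eq_sum_shift, Finset.mul_sum]
  refine Finset.sum_congr rfl fun j hj => ?_
  have hj' : j ≤ n := Nat.lt_succ_iff.1 (Finset.mem_range.1 hj)
  have : (-1 : 𝕂) ^ n * (-1) ^ (n - j) = (-1) ^ j := by
    obtain ⟨r, rfl⟩ := Nat.exists_eq_add_of_le hj'
    rw [Nat.add_sub_cancel_left, pow_add, mul_assoc, ← mul_pow]; simp
  rw [zsmul_eq_mul, ← this]
  simp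
  ring

lemma sum_choose_mul_ascPochhammer_eq_zero (s : 𝕂) {i n : ℕ} (hin : i < n) :
    ∑ j ∈ range (n + 1), (-1) ^ j * n.choose j * (ascPochhammer 𝕂 i).eval (s + j) = 0 := by
  rw [sum_choose_mul_ascPochhammer, Polynomial.fwdDiff_iter_eq_zero_of_degree_lt]
  · simp
  · rwa [ascPochhammer_natDegree]

lemma sum_choose_mul_ascPochhammer_self (s : 𝕂) (n : ℕ) :
    ∑ j ∈ range (n + 1), (-1) ^ j * n.choose j * (ascPochhammer 𝕂 n).eval (s + j) =
      (-1) ^ n * n.factorial := by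
  rw [sum_choose_mul_ascPochhammer]
  have h := Polynomial.fwdDiff_iter_degree_eq_factorial (ascPochhammer 𝕂 n)
  rw [ascPochhammer_natDegree, (monic_ascPochhammer 𝕂 n).leadingCoeff] at h
  rw [h]; simp

lemma gammaFunctional_mul_laguerre_eq_zero {s : 𝕂} (hs : ∀ n : ℕ, s + n ≠ 0) {q : 𝕂[X]} {n : ℕ}
    (hq : q.natDegree < n) : gammaFunctional s (q * laguerre s n) = 0 := by
  rw [q.as_sum_range_C_mul_X_pow, Finset.sum_mul, map_sum]
  refine Finset.sum_eq_zero fun i hi => ?_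
  rw [mul_assoc, ← smul_eq_C_mul, map_smul, gammaFunctional_X_pow_mul_laguerre hs,
    sum_choose_mul_ascPochhammer_eq_zero, smul_zero]
  exact (Nat.lt_succ_iff.1 (Finset.mem_range.1 hi)).trans_lt hq

lemma gammaFunctional_laguerre_sq {s : 𝕂} (hs : ∀ n : ℕ, s + n ≠ 0) (n : ℕ) :
    gammaFunctional s (laguerre s n * laguerre s n) = laguerreNorm s n := by
  nth_rewrite 1 [laguerre_eq_sum]
  rw [Finset.sum_mul, map_sum, Finset.sum_range_succ, Finset.sum_eq_zero, zero_add]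
  · rw [← mul_one ((-1 : 𝕂) ^ n * _ / _), ← C_mul_X_pow_eq_monomial, mul_one, mul_assoc,
      ← smul_eq_C_mul, map_smul, gammaFunctional_X_pow_mul_laguerre hs,
      sum_choose_mul_ascPochhammer_self, laguerreNorm]
    simp only [Nat.choose_self, Nat.cast_one, mul_one, smul_eq_mul]
    rw [div_mul_eq_mul_div, ← mul_assoc, ← mul_pow]
    simp
  · intro j hj
    exact gammaFunctional_mul_laguerre_eq_zero hs
      ((natDegree_monomial_le _).trans_lt (Finset.mem_range.1 hj))

lemma gammaFunctional_laguerre_mul_laguerre {s : 𝕂} (hs : ∀ n : ℕ, s + n ≠ 0) (m n : ℕ) :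
    gammaFunctional s (laguerre s m * laguerre s n) = if m = n then laguerreNorm s n else 0 := by
  split_ifs with h
  · rw [h, gammaFunctional_laguerre_sq hs]
  · rcases lt_or_gt_of_ne h with h | h
    · exact gammaFunctional_mul_laguerre_eq_zero hs ((natDegree_laguerre_le s m).trans_lt h)
    · rw [mul_comm]
      exact gammaFunctional_mul_laguerre_eq_zero hs ((natDegree_laguerre_le s n).trans_lt h)

lemma gammaFunctional_laguerre_sq_comp {s : 𝕂} (hs : ∀ n : ℕ, s + n ≠ 0) (c : 𝕂) (n : ℕ) :
    gammaFunctional s ((laguerre s n * laguerre s n).comp (C c * X)) =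
      ∑ j ∈ range (n + 1),
        (n.choose j) ^ 2 * laguerreNorm s j * ((1 - c) ^ 2) ^ (n - j) * (c ^ 2) ^ j := by
  rw [mul_comp, laguerre_comp_C_mul_X, Finset.sum_mul_sum, map_sum]
  refine Finset.sum_congr rfl fun j hj => ?_
  rw [map_sum]
  have h : ∀ i, gammaFunctional s (C (n.choose j * (1 - c) ^ (n - j) * c ^ j) * laguerre s j *
      (C (n.choose i * (1 - c) ^ (n - i) * c ^ i) * laguerre s i)) =
      if j = i then (n.choose j) ^ 2 * laguerreNorm s j * ((1 - c) ^ 2) ^ (n - j) * (c ^ 2) ^ j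
      else 0 := by
    intro i
    rw [mul_mul_mul_comm, ← map_mul, ← smul_eq_C_mul, map_smul,
      gammaFunctional_laguerre_mul_laguerre hs]
    split_ifs with h
    · subst h
      rw [smul_eq_mul, ← pow_mul, ← pow_mul, mul_comm 2, mul_comm 2, pow_mul, pow_mul]
      ring
    · simp
  simp only [h, Finset.sum_ite_eq, hj, if_true]

lemma laguerreNorm_succ {s : 𝕂} (hs : ∀ n : ℕ, s + n ≠ 0) (n : ℕ) :
    laguerreNorm s (n + 1) * (n + s) = (n + 1) * laguerreNorm s n := by
  have h1 := eval_ascPochhammer_ne_zero hs n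
  have h2 := hs n
  have h3 : (n : 𝕂) + s ≠ 0 := by rwa [add_comm]
  simp only [laguerreNorm, ascPochhammer_succ_eval, Nat.factorial_succ]
  push_cast
  field_simp
  ring

end Laguerre

/-! ### The Fourier transform of the gamma density -/

/-- The point `1 / (1 - i k)`, which lies on the circle with diameter `[0, 1]`. -/
noncomputable def resolventPoint (k : ℝ) : ℂ := (1 - Complex.I * k)⁻¹

lemma one_sub_I_mul_ne_zero (k : ℝ) : 1 - Complex.I * k ≠ 0 := by
  intro h
  have := congrArg Complex.re h
  simp at this

lemma resolventPoint_ne_zero (k : ℝ) : resolventPoint k ≠ 0 :=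
  inv_ne_zero (one_sub_I_mul_ne_zero k)

lemma normSq_one_sub_I_mul (k : ℝ) : Complex.normSq (1 - Complex.I * k) = 1 + k ^ 2 := by
  rw [Complex.normSq_apply]; simp; ring

lemma resolventPoint_re (k : ℝ) : (resolventPoint k).re = 1 / (1 + k ^ 2) := by
  rw [resolventPoint, Complex.inv_re, normSq_one_sub_I_mul]; simp

lemma resolventPoint_im (k : ℝ) : (resolventPoint k).im = k / (1 + k ^ 2) := by
  rw [resolventPoint, Complex.inv_im, normSq_one_sub_I_mul]; simp

lemma norm_resolventPoint_sq (k : ℝ) : ‖resolventPoint k‖ ^ 2 = 1 / (1 + k ^ 2) := by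
  rw [← Complex.normSq_eq_norm_sq, resolventPoint, Complex.normSq_inv, normSq_one_sub_I_mul,
    one_div]

lemma resolventPoint_mem_slitPlane (k : ℝ) : resolventPoint k ∈ Complex.slitPlane :=
  Or.inl (by rw [resolventPoint_re]; positivity)

lemma hasDerivAt_resolventPoint (k : ℝ) :
    HasDerivAt resolventPoint (Complex.I * resolventPoint k ^ 2) k := by
  have h1 : HasDerivAt (fun k : ℝ => 1 - Complex.I * (k : ℂ)) (-(Complex.I * 1)) k :=
    ((Complex.ofRealCLM.hasDerivAt (x := k)).const_mul Complex.I).const_sub 1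
  have h2 := h1.inv (one_sub_I_mul_ne_zero k)
  refine h2.congr_deriv ?_
  simp only [resolventPoint, inv_pow]
  ring

lemma one_sub_mul_resolventPoint (k : ℝ) : (1 - Complex.I * k) * resolventPoint k = 1 :=
  mul_inv_cancel₀ (one_sub_I_mul_ne_zero k)

lemma one_add_sq_ne_zero (k : ℝ) : (1 + k ^ 2 : ℂ) ≠ 0 := by
  have : (1 + k ^ 2 : ℝ) ≠ 0 := by positivity
  exact_mod_cast this

lemma resolventPoint_sq (k : ℝ) :
    resolventPoint k ^ 2 = ((1 / (1 + k ^ 2) : ℝ) : ℂ) * (2 * resolventPoint k - 1) := by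
  have h := one_sub_I_mul_ne_zero k
  have h' := one_add_sq_ne_zero k
  rw [resolventPoint]
  push_cast
  field_simp
  linear_combination (k : ℂ) ^ 2 * Complex.I_sq

lemma one_sub_resolventPoint_sq (k : ℝ) :
    (1 - resolventPoint k) ^ 2 =
      ((1 / (1 + k ^ 2) - 1 : ℝ) : ℂ) * (2 * resolventPoint k - 1) := by
  have h := resolventPoint_sq k
  push_cast at h ⊢
  linear_combination h

lemma norm_two_mul_resolventPoint_sub_one (k : ℝ) : ‖2 * resolventPoint k - 1‖ = 1 := by
  have h : ‖2 * resolventPoint k - 1‖ ^ 2 = 1 := by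
    rw [← Complex.normSq_eq_norm_sq, Complex.normSq_apply]
    simp [resolventPoint_re, resolventPoint_im]
    field_simp
    ring
  have h0 := norm_nonneg (2 * resolventPoint k - 1)
  nlinarith

lemma hasDerivAt_resolventPoint_cpow (σ : ℂ) (k : ℝ) :
    HasDerivAt (fun k => resolventPoint k ^ σ)
      (Complex.I * σ * resolventPoint k * resolventPoint k ^ σ) k := by
  have h := ((hasDerivAt_id (resolventPoint k)).cpow_const (c := σ)
    (resolventPoint_mem_slitPlane k)).comp k (hasDerivAt_resolventPoint k)
  refine h.congr_deriv ?_
  rw [id, Complex.cpow_sub _ _ (resolventPoint_ne_zero k), Complex.cpow_one]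
  have := resolventPoint_ne_zero k
  field_simp

/-- The Fourier transform of the gamma density `x ^ (σ - 1) * exp (-x)` on the half-line. -/
noncomputable def gammaFourier (σ k : ℝ) : ℂ :=
  ∫ x in Set.Ioi (0 : ℝ), Complex.exp (Complex.I * k * x) *
    ((Real.exp (-x) * x ^ (σ - 1) : ℝ) : ℂ)

lemma integrableOn_gammaFourier {σ : ℝ} (hσ : 0 < σ) (k : ℝ) :
    IntegrableOn (fun x : ℝ => Complex.exp (Complex.I * k * x) *
      ((Real.exp (-x) * x ^ (σ - 1) : ℝ) : ℂ)) (Set.Ioi 0) :=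
  (Real.GammaIntegral_convergent hσ).ofReal.bdd_mul (c := 1)
    (by fun_prop) (ae_of_all _ fun x => (norm_exp_I_mul_mul k x).le)

lemma hasDerivAt_gammaFourier {σ : ℝ} (hσ : 0 < σ) (k : ℝ) :
    HasDerivAt (gammaFourier σ) (Complex.I * gammaFourier (σ + 1) k) k := by
  have h := hasDerivAt_integral_of_dominated_loc_of_deriv_le
    (μ := volume.restrict (Set.Ioi (0 : ℝ)))
    (F := fun (k x : ℝ) => Complex.exp (Complex.I * k * x) *
      ((Real.exp (-x) * x ^ (σ - 1) : ℝ) : ℂ))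
    (F' := fun (k x : ℝ) => Complex.I * (Complex.exp (Complex.I * k * x) *
      ((Real.exp (-x) * x ^ (σ + 1 - 1) : ℝ) : ℂ)))
    (bound := fun x => Real.exp (-x) * x ^ (σ + 1 - 1))
    (x₀ := k) (s := Set.univ) Filter.univ_mem
    (Filter.Eventually.of_forall fun k => (integrableOn_gammaFourier hσ k).aestronglyMeasurable)
    (integrableOn_gammaFourier hσ k)
    ((integrableOn_gammaFourier (by linarith : 0 < σ + 1) k).aestronglyMeasurable.const_mul _)
    ?_ (Real.GammaIntegral_convergent (by linarith)) ?_
  · have h2 := h.2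
    rw [integral_const_mul] at h2
    exact h2
  · refine (ae_restrict_iff' measurableSet_Ioi).2 (ae_of_all _ fun x hx k _ => ?_)
    have hx' : (0 : ℝ) < x := hx
    rw [norm_mul, norm_mul, norm_exp_I_mul_mul, Complex.norm_I, one_mul, one_mul, Complex.norm_real,
      Real.norm_of_nonneg (by positivity)]
  · refine (ae_restrict_iff' measurableSet_Ioi).2 (ae_of_all _ fun x hx k _ => ?_)
    have hx' : (0 : ℝ) < x := hx
    have h1 : HasDerivAt (fun k : ℝ => Complex.I * (k : ℂ) * x) (Complex.I * 1 * x) k :=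
      ((Complex.ofRealCLM.hasDerivAt (x := k)).const_mul Complex.I).mul_const _
    have h2 := h1.cexp.mul_const ((Real.exp (-x) * x ^ (σ - 1) : ℝ) : ℂ)
    refine h2.congr_deriv ?_
    rw [show σ + 1 - 1 = σ - 1 + 1 by ring, Real.rpow_add_one hx'.ne']
    push_cast
    ring

/-- Integration by parts, applied to `exp (i k x) * exp (-x) * x ^ σ`. -/
lemma gammaFourier_add_one {σ : ℝ} (hσ : 0 < σ) (k : ℝ) :
    (1 - Complex.I * k) * gammaFourier (σ + 1) k = σ * gammaFourier σ k := by
  have hσ' : 0 < σ + 1 := by linarith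
  have i1 := integrableOn_gammaFourier hσ k
  have i2 := integrableOn_gammaFourier hσ' k
  have h := integral_Ioi_of_hasDerivAt_of_tendsto (a := 0) (m := (0 : ℂ))
    (f := fun x : ℝ => Complex.exp (Complex.I * k * x) * ((Real.exp (-x) * x ^ σ : ℝ) : ℂ))
    (f' := fun x : ℝ => σ * (Complex.exp (Complex.I * k * x) *
        ((Real.exp (-x) * x ^ (σ - 1) : ℝ) : ℂ)) - (1 - Complex.I * k) *
        (Complex.exp (Complex.I * k * x) * ((Real.exp (-x) * x ^ (σ + 1 - 1) : ℝ) : ℂ)))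
    ?_ ?_ ((i1.const_mul _).sub (i2.const_mul _)) ?_
  · rw [integral_sub (i1.const_mul _) (i2.const_mul _), integral_const_mul,
      integral_const_mul] at h
    simp only [Real.zero_rpow hσ.ne', mul_zero, Complex.ofReal_zero, sub_self] at h
    exact (sub_eq_zero.1 h).symm
  · refine Continuous.continuousWithinAt ?_
    have : Continuous fun x : ℝ => x ^ σ := Real.continuous_rpow_const hσ.le
    fun_prop
  · intro x hx
    have hx' : (0 : ℝ) < x := hx
    have h1 : HasDerivAt (fun x : ℝ => Complex.I * k * (x : ℂ)) (Complex.I * k * 1) x :=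
      (Complex.ofRealCLM.hasDerivAt (x := x)).const_mul _
    have h2 : HasDerivAt (fun x : ℝ => Real.exp (-x) * x ^ σ)
        (Real.exp (-x) * -1 * x ^ σ + Real.exp (-x) * (σ * x ^ (σ - 1))) x :=
      ((hasDerivAt_id x).neg.exp).mul (Real.hasDerivAt_rpow_const (Or.inl hx'.ne'))
    refine (h1.cexp.mul h2.ofReal_comp).congr_deriv ?_
    rw [show σ + 1 - 1 = σ by ring]
    push_cast
    ring
  · rw [tendsto_zero_iff_norm_tendsto_zero]
    have h1 := tendsto_rpow_mul_exp_neg_mul_atTop_nhds_zero σ 1 one_pos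
    refine h1.congr' ?_
    filter_upwards [Filter.eventually_ge_atTop 0] with x hx
    rw [norm_mul, norm_exp_I_mul_mul, one_mul, Complex.norm_real,
      Real.norm_of_nonneg (by positivity), neg_one_mul, mul_comm]

/-- The function `k ↦ gammaFourier σ k * (1 - i k) ^ σ` has derivative zero. -/
theorem gammaFourier_eq {σ : ℝ} (hσ : 0 < σ) (k : ℝ) :
    gammaFourier σ k = Real.Gamma σ * resolventPoint k ^ (σ : ℂ) := by
  have hd : ∀ k, HasDerivAt (fun k => gammaFourier σ k * resolventPoint k ^ (-(σ : ℂ))) 0 k := by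
    intro k
    refine ((hasDerivAt_gammaFourier hσ k).mul
      (hasDerivAt_resolventPoint_cpow (-(σ : ℂ)) k)).congr_deriv ?_
    have h := gammaFourier_add_one hσ k
    have h2 := one_sub_mul_resolventPoint k
    linear_combination (Complex.I * resolventPoint k ^ (-(σ : ℂ)) * resolventPoint k) * h -
      (Complex.I * resolventPoint k ^ (-(σ : ℂ)) * gammaFourier (σ + 1) k) * h2
  have hc := is_const_of_deriv_eq_zero (fun k => (hd k).differentiableAt) (fun k => (hd k).deriv)
    k 0
  have h0 : gammaFourier σ 0 = Real.Gamma σ := by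
    rw [gammaFourier, Real.Gamma_eq_integral hσ, ← integral_complex_ofReal]
    simp
  have h1 : resolventPoint 0 = 1 := by simp [resolventPoint]
  simp only [h0, h1, Complex.one_cpow, mul_one] at hc
  rw [← hc, mul_assoc, ← Complex.cpow_add _ _ (resolventPoint_ne_zero k)]
  simp

/-! ### Matrix elements of `exp (i k x)` in the Laguerre basis -/

/-- The functional `q ↦ ∫ exp (i k x) * q x * x ^ (s - 1) * exp (-x) dx / Γ s` on polynomials, in
closed form: the gamma functional of the polynomial `q (x / (1 - i k))`, times
`(1 - i k) ^ (-s)`. -/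
noncomputable def fourierFunctional (s k : ℝ) : ℂ[X] →ₗ[ℂ] ℂ :=
  resolventPoint k ^ (s : ℂ) •
    (gammaFunctional (s : ℂ) ∘ₗ (aeval (C (resolventPoint k) * X : ℂ[X])).toLinearMap)

lemma fourierFunctional_apply (s k : ℝ) (q : ℂ[X]) : fourierFunctional s k q =
    resolventPoint k ^ (s : ℂ) *
      gammaFunctional (s : ℂ) (q.comp (C (resolventPoint k) * X)) := by
  simp [fourierFunctional, comp_eq_aeval]

lemma fourierFunctional_monomial (s k : ℝ) (j : ℕ) (c : ℂ) :
    fourierFunctional s k (monomial j c) = c * (ascPochhammer ℂ j).eval (s : ℂ) *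
      (resolventPoint k ^ j * resolventPoint k ^ (s : ℂ)) := by
  have h : (monomial j c).comp (C (resolventPoint k) * X) =
      monomial j (c * resolventPoint k ^ j) := by
    rw [monomial_comp, mul_pow, ← C_pow, ← mul_assoc, ← C_mul, C_mul_X_pow_eq_monomial]
  rw [fourierFunctional_apply, h, gammaFunctional_monomial]
  ring

lemma fourierFunctional_C_mul (s k : ℝ) (c : ℂ) (q : ℂ[X]) :
    fourierFunctional s k (C c * q) = c * fourierFunctional s k q := by
  rw [← smul_eq_C_mul, map_smul, smul_eq_mul]

lemma fourierFunctional_zero_right (s : ℝ) (q : ℂ[X]) :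
    fourierFunctional s 0 q = gammaFunctional (s : ℂ) q := by
  have h1 : resolventPoint 0 = 1 := by simp [resolventPoint]
  simp [fourierFunctional_apply, h1]

lemma hasDerivAt_fourierFunctional (s k : ℝ) (q : ℂ[X]) :
    HasDerivAt (fun k => fourierFunctional s k q)
      (Complex.I * fourierFunctional s k (X * q)) k := by
  induction q using Polynomial.induction_on' with
  | add p q hp hq =>
    simp only [mul_add, map_add]
    exact hp.add hq
  | monomial j c =>
    simp only [X_mul_monomial, fourierFunctional_monomial]
    have h1 := (hasDerivAt_resolventPoint k).pow j
    have h2 := (h1.mul (hasDerivAt_resolventPoint_cpow (s : ℂ) k)).const_mul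
      (c * (ascPochhammer ℂ j).eval (s : ℂ))
    refine h2.congr_deriv ?_
    rw [ascPochhammer_succ_eval]
    simp only [Pi.pow_apply]
    cases j with
    | zero => simp; ring
    | succ j => simp only [Nat.add_sub_cancel]; push_cast; ring

/-- Integration by parts: the integral of the derivative of
`exp (i k x) * q x * x ^ s * exp (-x)` over the half-line vanishes. -/
lemma fourierFunctional_integration_by_parts (s k : ℝ) (q : ℂ[X]) :
    s * fourierFunctional s k q + fourierFunctional s k (X * derivative q) -
      (1 - Complex.I * k) * fourierFunctional s k (X * q) = 0 := by
  induction q using Polynomial.induction_on' with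
  | add p q hp hq =>
    simp only [mul_add, map_add]
    linear_combination hp + hq
  | monomial j c =>
    have h1 : X * derivative (monomial j c) = monomial j (c * j) := by
      rw [derivative_monomial, X_mul_monomial]
      cases j with
      | zero => simp
      | succ j => rfl
    have h2 := one_sub_mul_resolventPoint k
    rw [h1, X_mul_monomial]
    simp only [fourierFunctional_monomial, ascPochhammer_succ_eval]
    linear_combination (-c * (ascPochhammer ℂ j).eval (s : ℂ) * (s + j) * resolventPoint k ^ j *
      resolventPoint k ^ (s : ℂ)) * h2

lemma Gamma_add_natCast {s : ℝ} (hs : 0 < s) (j : ℕ) :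
    Real.Gamma (s + j) = (ascPochhammer ℝ j).eval s * Real.Gamma s := by
  induction j with
  | zero => simp
  | succ j ih =>
    have : s + j ≠ 0 := by positivity
    rw [ascPochhammer_succ_eval, Nat.cast_succ, ← add_assoc, Real.Gamma_add_one this, ih]
    ring

lemma ofReal_eval_ascPochhammer (s : ℝ) (j : ℕ) :
    (((ascPochhammer ℝ j).eval s : ℝ) : ℂ) = (ascPochhammer ℂ j).eval (s : ℂ) := by
  rw [← ascPochhammer_map Complex.ofRealHom]
  exact (eval_map_apply (f := Complex.ofRealHom) s).symm

lemma laguerreWeight_mul_pow (a x : ℝ) (j : ℕ) : laguerreWeight a x * x ^ j =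
    Set.indicator (Set.Ioi 0) (fun x => Real.exp (-x) * x ^ (a + 1 + j - 1)) x := by
  by_cases hx : x ∈ Set.Ioi (0 : ℝ)
  · have hx' : (0 : ℝ) < x := hx
    rw [laguerreWeight, Set.indicator_of_mem hx, Set.indicator_of_mem hx,
      show a + 1 + j - 1 = a + j by ring, Real.rpow_add_natCast hx'.ne']
    ring
  · rw [laguerreWeight, Set.indicator_of_notMem hx, Set.indicator_of_notMem hx, zero_mul]

lemma integrable_laguerreWeight_mul {a : ℝ} (ha : -1 < a) (q : ℝ[X]) :
    Integrable fun x => laguerreWeight a x * q.eval x := by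
  induction q using Polynomial.induction_on' with
  | add p q hp hq =>
    simp only [eval_add, mul_add]
    exact hp.add hq
  | monomial j c =>
    have h : ∀ x, laguerreWeight a x * (monomial j c).eval x =
        c * (laguerreWeight a x * x ^ j) := fun x => by rw [eval_monomial]; ring
    simp only [h, laguerreWeight_mul_pow]
    refine Integrable.const_mul ?_ c
    rw [integrable_indicator_iff measurableSet_Ioi]
    have hj : (0 : ℝ) ≤ j := j.cast_nonneg
    exact Real.GammaIntegral_convergent (by linarith)

lemma integral_exp_mul_laguerreWeight {a : ℝ} (ha : -1 < a) (k : ℝ) (q : ℝ[X]) :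
    ∫ x : ℝ, Complex.exp (Complex.I * k * x) * ((laguerreWeight a x * q.eval x : ℝ) : ℂ) =
      Real.Gamma (a + 1) * fourierFunctional (a + 1) k (q.map Complex.ofRealHom) := by
  have hint : ∀ q : ℝ[X], Integrable fun x : ℝ => Complex.exp (Complex.I * k * x) *
      ((laguerreWeight a x * q.eval x : ℝ) : ℂ) := fun q =>
    ((integrable_laguerreWeight_mul ha q).ofReal (𝕜 := ℂ)).bdd_mul (c := 1)
      (by fun_prop) (ae_of_all _ fun x => (norm_exp_I_mul_mul k x).le)
  induction q using Polynomial.induction_on' with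
  | add p q hp hq =>
    rw [Polynomial.map_add, map_add, mul_add, ← hp, ← hq, ← integral_add (hint p) (hint q)]
    simp only [eval_add, mul_add, Complex.ofReal_add]
  | monomial j c =>
    have hj : (0 : ℝ) ≤ j := j.cast_nonneg
    have hs : 0 < a + 1 := by linarith
    have h : ∀ x : ℝ, Complex.exp (Complex.I * k * x) *
        ((laguerreWeight a x * (monomial j c).eval x : ℝ) : ℂ) =
        c * Set.indicator (Set.Ioi 0) (fun x : ℝ => Complex.exp (Complex.I * k * x) *
          ((Real.exp (-x) * x ^ (a + 1 + j - 1) : ℝ) : ℂ)) x := by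
      intro x
      rw [eval_monomial, mul_left_comm, laguerreWeight_mul_pow]
      by_cases hx : x ∈ Set.Ioi (0 : ℝ)
      · rw [Set.indicator_of_mem hx, Set.indicator_of_mem hx]; push_cast; ring
      · rw [Set.indicator_of_notMem hx, Set.indicator_of_notMem hx]; simp
    simp only [h]
    rw [integral_const_mul, integral_indicator measurableSet_Ioi]
    have h2 := gammaFourier_eq (show 0 < a + 1 + j by linarith) k
    rw [gammaFourier] at h2
    rw [h2, map_monomial, fourierFunctional_monomial, Gamma_add_natCast hs,
      Complex.ofReal_mul, ofReal_eval_ascPochhammer, Complex.ofReal_add (a + 1),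
      Complex.ofReal_natCast, Complex.cpow_add _ _ (resolventPoint_ne_zero k),
      Complex.cpow_natCast, Complex.ofRealHom_eq_coe]
    ring

/-- The Fourier transform `∫ exp (i k x) * ℓ_m x * ℓ_n x * x ^ (s - 1) * exp (-x) dx / Γ s` for
the Laguerre polynomials `ℓ_n = laguerre s n`. -/
noncomputable def laguerreFourier (s k : ℝ) (m n : ℕ) : ℂ :=
  fourierFunctional s k (laguerre (s : ℂ) m * laguerre (s : ℂ) n)

section

variable {s : ℝ}

lemma add_natCast_ne_zero (hs : 0 < s) (n : ℕ) : s + n ≠ 0 := by positivity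

lemma ofReal_add_natCast_ne_zero (hs : 0 < s) (n : ℕ) : (s : ℂ) + n ≠ 0 := by
  exact_mod_cast add_natCast_ne_zero hs n

lemma laguerreNorm_pos (hs : 0 < s) (n : ℕ) : 0 < laguerreNorm s n :=
  div_pos (by positivity) (ascPochhammer_pos n s hs)

lemma ofReal_laguerreNorm (s : ℝ) (n : ℕ) :
    ((laguerreNorm s n : ℝ) : ℂ) = laguerreNorm (s : ℂ) n := by
  simp [laguerreNorm, ofReal_eval_ascPochhammer]

lemma fourierFunctional_X_mul_laguerre_mul (hs : 0 < s) (k : ℝ) (m n : ℕ) :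
    fourierFunctional s k (X * (laguerre (s : ℂ) m * laguerre (s : ℂ) n)) =
      (2 * m + s) * laguerreFourier s k m n - (m + s) * laguerreFourier s k (m + 1) n -
        m * laguerreFourier s k (m - 1) n := by
  rw [← mul_assoc, X_mul_laguerre (ofReal_add_natCast_ne_zero hs)]
  simp only [sub_mul, map_sub, mul_assoc, fourierFunctional_C_mul, laguerreFourier]

lemma hasDerivAt_laguerreFourier (hs : 0 < s) (k : ℝ) (m n : ℕ) :
    HasDerivAt (fun k => laguerreFourier s k m n)
      (Complex.I * ((2 * m + s) * laguerreFourier s k m n -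
        (m + s) * laguerreFourier s k (m + 1) n - m * laguerreFourier s k (m - 1) n)) k := by
  rw [← fourierFunctional_X_mul_laguerre_mul hs]
  exact hasDerivAt_fourierFunctional s k _

/-- Integration by parts expresses the off-diagonal terms of the derivative of
`laguerreFourier s k n n` through that derivative itself. -/
lemma laguerreFourier_succ_sub_pred (hs : 0 < s) (k : ℝ) (n : ℕ) :
    (n + s) * laguerreFourier s k (n + 1) n - n * laguerreFourier s k (n - 1) n =
      -k * (Complex.I * ((2 * n + s) * laguerreFourier s k n n -
        (n + s) * laguerreFourier s k (n + 1) n - n * laguerreFourier s k (n - 1) n)) := by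
  have h1 := fourierFunctional_integration_by_parts s k
    (laguerre (s : ℂ) n * laguerre (s : ℂ) n)
  have h2 : X * derivative (laguerre (s : ℂ) n * laguerre (s : ℂ) n) =
      C (2 * n : ℂ) * (laguerre (s : ℂ) n * laguerre (s : ℂ) n) -
        C (2 * n : ℂ) * (laguerre (s : ℂ) (n - 1) * laguerre (s : ℂ) n) := by
    rw [derivative_mul]
    have := X_mul_derivative_laguerre (s : ℂ) n
    simp only [map_mul, map_ofNat]
    linear_combination (2 * laguerre (s : ℂ) n) * this
  rw [h2, fourierFunctional_X_mul_laguerre_mul hs, map_sub, fourierFunctional_C_mul,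
    fourierFunctional_C_mul] at h1
  simp only [laguerreFourier] at h1 ⊢
  linear_combination h1

end

/-- The Jacobi polynomial for the weight `x ^ (s - 1)` on `[0, 1]`, normalised to have the value `1`
at `1`. The sum is the Leibniz expansion of the Rodrigues formula
`x ^ (1 - s) * (d / dx) ^ n (x ^ (n + s - 1) * (x - 1) ^ n) / n!`. -/
noncomputable def jacobi (s : ℝ) (n : ℕ) : ℝ[X] :=
  ∑ j ∈ range (n + 1),
    C ((n.choose j) ^ 2 * laguerreNorm s j / laguerreNorm s n) * (X ^ j * (X - 1) ^ (n - j))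

section

variable {s : ℝ}

/-- The diagonal matrix elements of `exp (i k x)` in the Laguerre basis are Jacobi polynomials in
`1 / (1 + k ^ 2)`, up to an explicit phase and a power of `1 + k ^ 2`. -/
lemma laguerreFourier_self (hs : 0 < s) (k : ℝ) (n : ℕ) :
    laguerreFourier s k n n = resolventPoint k ^ (s : ℂ) * (2 * resolventPoint k - 1) ^ n *
      ((laguerreNorm s n * (jacobi s n).eval (1 / (1 + k ^ 2)) : ℝ) : ℂ) := by
  have hn := (laguerreNorm_pos hs n).ne'
  rw [laguerreFourier, fourierFunctional_apply,
    gammaFunctional_laguerre_sq_comp (ofReal_add_natCast_ne_zero hs), jacobi, eval_finsetSum,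
    mul_assoc]
  congr 1
  rw [Finset.mul_sum, Complex.ofReal_sum, Finset.mul_sum]
  refine Finset.sum_congr rfl fun j hj => ?_
  have hj' : j + (n - j) = n := Nat.add_sub_of_le (Nat.lt_succ_iff.1 (Finset.mem_range.1 hj))
  rw [resolventPoint_sq, one_sub_resolventPoint_sq, mul_pow, mul_pow]
  conv_rhs => rw [← hj', pow_add, hj']
  have h : laguerreNorm s n * eval (1 / (1 + k ^ 2)) (C ((n.choose j) ^ 2 * laguerreNorm s j /
      laguerreNorm s n) * (X ^ j * (X - 1) ^ (n - j))) =
      (n.choose j) ^ 2 * laguerreNorm s j * ((1 / (1 + k ^ 2)) ^ j *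
        (1 / (1 + k ^ 2) - 1) ^ (n - j)) := by
    simp only [eval_mul, eval_C, eval_pow, eval_X, eval_sub, eval_one]
    field_simp
  rw [h, ← ofReal_laguerreNorm]
  push_cast
  ring

lemma norm_laguerreFourier_self_sq (hs : 0 < s) (k : ℝ) (n : ℕ) :
    ‖laguerreFourier s k n n‖ ^ 2 = (1 / (1 + k ^ 2)) ^ s *
      (laguerreNorm s n * (jacobi s n).eval (1 / (1 + k ^ 2))) ^ 2 := by
  rw [laguerreFourier_self hs, norm_mul, norm_mul, norm_pow, norm_two_mul_resolventPoint_sub_one,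
    one_pow, mul_one, mul_pow, Complex.norm_real, Real.norm_eq_abs, sq_abs,
    Complex.norm_cpow_real, ← Real.rpow_natCast, ← Real.rpow_mul (norm_nonneg _), mul_comm s,
    Real.rpow_mul (norm_nonneg _), Real.rpow_natCast, norm_resolventPoint_sq]

lemma hasDerivAt_one_div_one_add_sq (k : ℝ) :
    HasDerivAt (fun k : ℝ => 1 / (1 + k ^ 2)) (-2 * k * (1 / (1 + k ^ 2)) ^ 2) k := by
  have h1 : HasDerivAt (fun k : ℝ => 1 + k ^ 2) (2 * k) k := by
    simpa using ((hasDerivAt_id k).pow 2).const_add 1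
  have h2 := h1.inv (by positivity : (1 + k ^ 2 : ℝ) ≠ 0)
  simp only [one_div]
  refine h2.congr_deriv ?_
  field_simp

/-- The argument of `laguerreFourier s k n n` rotates at the rate `(2 n + s) / (1 + k ^ 2)`. -/
lemma im_conj_laguerreFourier_mul_deriv (hs : 0 < s) (k : ℝ) (n : ℕ) {d : ℂ}
    (hd : HasDerivAt (fun k => laguerreFourier s k n n) d k) :
    ((starRingEnd ℂ) (laguerreFourier s k n n) * d).im =
      (2 * n + s) * (1 / (1 + k ^ 2)) * ‖laguerreFourier s k n n‖ ^ 2 := by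
  obtain ⟨r', hr⟩ : ∃ r', HasDerivAt (fun k : ℝ =>
      laguerreNorm s n * (jacobi s n).eval (1 / (1 + k ^ 2))) r' k :=
    ⟨_, (((jacobi s n).hasDerivAt _).comp k (hasDerivAt_one_div_one_add_sq k)).const_mul _⟩
  have he : HasDerivAt (fun k => resolventPoint k ^ (s : ℂ) * (2 * resolventPoint k - 1) ^ n)
      (Complex.I * (s * resolventPoint k + 2 * n * ((1 / (1 + k ^ 2) : ℝ) : ℂ)) *
        (resolventPoint k ^ (s : ℂ) * (2 * resolventPoint k - 1) ^ n)) k := by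
    have h1 := (((hasDerivAt_resolventPoint k).const_mul 2).sub_const 1).pow n
    refine ((hasDerivAt_resolventPoint_cpow (s : ℂ) k).mul h1).congr_deriv ?_
    simp only [Pi.pow_apply]
    rw [resolventPoint_sq]
    cases n with
    | zero => simp only [pow_zero, Nat.cast_zero]; ring
    | succ n => simp only [Nat.add_sub_cancel]; push_cast; ring
  have h := hd.unique ((he.mul hr.ofReal_comp).congr_of_eventuallyEq
    (Filter.Eventually.of_forall fun k => laguerreFourier_self hs k n))
  rw [h, laguerreFourier_self hs]
  generalize resolventPoint k ^ (s : ℂ) * (2 * resolventPoint k - 1) ^ n = e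
  generalize laguerreNorm s n * (jacobi s n).eval (1 / (1 + k ^ 2)) = r
  rw [← Complex.normSq_eq_norm_sq, ← resolventPoint_re]
  simp only [Complex.normSq_apply, Complex.mul_re, Complex.mul_im, Complex.conj_re,
    Complex.conj_im, Complex.I_re, Complex.I_im, Complex.add_re, Complex.add_im,
    Complex.ofReal_re, Complex.ofReal_im, Complex.natCast_re, Complex.natCast_im,
    Complex.re_ofNat, Complex.im_ofNat]
  ring

/-- The sum of the squared norms of the entries `(m, n)` and `(n, m)`, `m ≤ n`, of the symmetric
matrix of `exp (i k x)` in the normalised Laguerre basis. The diagonal entry counts once. -/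
noncomputable def hookSum (s k : ℝ) (n : ℕ) : ℝ :=
  (∑ m ∈ range n, ‖laguerreFourier s k m n‖ ^ 2 / laguerreNorm s m +
    ∑ m ∈ range (n + 1), ‖laguerreFourier s k m n‖ ^ 2 / laguerreNorm s m) / laguerreNorm s n

/-- The derivative telescopes because multiplication by `x` is a symmetric tridiagonal matrix in
the Laguerre basis. -/
lemma hasDerivAt_sum_norm_laguerreFourier_sq (hs : 0 < s) (k : ℝ) (M n : ℕ) :
    HasDerivAt (fun k => ∑ m ∈ range M, ‖laguerreFourier s k m n‖ ^ 2 / laguerreNorm s m)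
      (2 * M / laguerreNorm s M *
        ((starRingEnd ℂ) (laguerreFourier s k (M - 1) n) * laguerreFourier s k M n).im) k := by
  induction M with
  | zero => simpa using hasDerivAt_const k (0 : ℝ)
  | succ M ih =>
    simp only [Finset.sum_range_succ]
    refine (ih.add ((hasDerivAt_laguerreFourier hs k M n).norm_sq.div_const _)).congr_deriv ?_
    have h1 := laguerreNorm_succ (add_natCast_ne_zero hs) M
    have h2 := (laguerreNorm_pos hs M).ne'
    have h3 := (laguerreNorm_pos hs (M + 1)).ne'
    have h4 : ((M + 1 : ℕ) : ℝ) / laguerreNorm s (M + 1) = (M + s) / laguerreNorm s M := by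
      rw [div_eq_div_iff h3 h2]; push_cast; linear_combination -h1
    rw [mul_div_assoc, mul_div_assoc 2 ((M + 1 : ℕ) : ℝ), h4, Nat.add_sub_cancel, Complex.inner]
    simp only [Complex.mul_re, Complex.mul_im, Complex.conj_re, Complex.conj_im, Complex.I_re,
      Complex.I_im, Complex.sub_re, Complex.sub_im, Complex.add_re, Complex.add_im,
      Complex.ofReal_re, Complex.ofReal_im, Complex.natCast_re, Complex.natCast_im,
      Complex.re_ofNat, Complex.im_ofNat]
    field_simp
    ring

lemma hasDerivAt_hookSum (hs : 0 < s) (k : ℝ) (n : ℕ) :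
    HasDerivAt (fun k => hookSum s k n)
      (-2 * k * (2 * n + s) * (1 / (1 + k ^ 2)) * (1 / (1 + k ^ 2)) ^ s *
        (jacobi s n).eval (1 / (1 + k ^ 2)) ^ 2) k := by
  have hd := ((hasDerivAt_sum_norm_laguerreFourier_sq hs k n n).add
    (hasDerivAt_sum_norm_laguerreFourier_sq hs k (n + 1) n)).div_const (laguerreNorm s n)
  refine hd.congr_deriv ?_
  have h0 := im_conj_laguerreFourier_mul_deriv hs k n (hasDerivAt_laguerreFourier hs k n n)
  have hibp := laguerreFourier_succ_sub_pred hs k n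
  have h1 := laguerreNorm_succ (add_natCast_ne_zero hs) n
  have h2 := (laguerreNorm_pos hs n).ne'
  have h3 := (laguerreNorm_pos hs (n + 1)).ne'
  have h4 : ((n + 1 : ℕ) : ℝ) / laguerreNorm s (n + 1) = (n + s) / laguerreNorm s n := by
    rw [div_eq_div_iff h3 h2]; push_cast; linear_combination -h1
  rw [norm_laguerreFourier_self_sq hs] at h0
  rw [mul_div_assoc, mul_div_assoc 2 ((n + 1 : ℕ) : ℝ), h4, Nat.add_sub_cancel]
  -- `h6` collects the two boundary terms, and `h5` evaluates them by integration by parts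
  have h5 := congrArg (fun z => ((starRingEnd ℂ) (laguerreFourier s k n n) * z).im) hibp
  rw [mul_left_comm, ← Complex.ofReal_neg, Complex.im_ofReal_mul, h0] at h5
  have h6 : 2 * ((n : ℝ) / laguerreNorm s n) * ((starRingEnd ℂ) (laguerreFourier s k (n - 1) n) *
      laguerreFourier s k n n).im + 2 * ((n + s) / laguerreNorm s n) *
      ((starRingEnd ℂ) (laguerreFourier s k n n) * laguerreFourier s k (n + 1) n).im =
      2 / laguerreNorm s n * ((starRingEnd ℂ) (laguerreFourier s k n n) *
        ((n + s) * laguerreFourier s k (n + 1) n - n * laguerreFourier s k (n - 1) n)).im := by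
    simp only [Complex.mul_re, Complex.mul_im, Complex.conj_re,
      Complex.conj_im, Complex.sub_re, Complex.sub_im, Complex.add_re, Complex.add_im,
      Complex.ofReal_re, Complex.ofReal_im, Complex.natCast_re, Complex.natCast_im]
    ring
  rw [h6, h5]
  field_simp

lemma hookSum_zero (hs : 0 < s) (n : ℕ) : hookSum s 0 n = 1 := by
  have h : ∀ m, laguerreFourier s 0 m n = if m = n then ((laguerreNorm s n : ℝ) : ℂ) else 0 := by
    intro m
    rw [laguerreFourier, fourierFunctional_zero_right,
      gammaFunctional_laguerre_mul_laguerre (ofReal_add_natCast_ne_zero hs), ofReal_laguerreNorm]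
  have h2 := laguerreNorm_pos hs n
  rw [hookSum, Finset.sum_range_succ, Finset.sum_eq_zero, h n, if_pos rfl, Complex.norm_real,
    Real.norm_of_nonneg h2.le]
  · field_simp; simp
  · intro m hm
    rw [h, if_neg (Finset.mem_range.1 hm).ne]; simp

end

/-! ### Jacobi polynomials -/

lemma intervalIntegrable_rpow_mul {σ : ℝ} (hσ : 0 < σ) {f : ℝ → ℝ} (hf : Continuous f) (u v : ℝ) :
    IntervalIntegrable (fun x : ℝ => x ^ (σ - 1) * f x) volume u v :=
  (intervalIntegral.intervalIntegrable_rpow' (by linarith)).mul_continuousOn hf.continuousOn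

lemma intervalIntegrable_rpow_mul_eval {σ : ℝ} (hσ : 0 < σ) (q : ℝ[X]) (u v : ℝ) :
    IntervalIntegrable (fun x : ℝ => x ^ (σ - 1) * q.eval x) volume u v :=
  intervalIntegrable_rpow_mul hσ q.continuous u v

/-- The Beta integral with one integer parameter. -/
lemma integral_rpow_mul_one_sub_pow {σ : ℝ} (hσ : 0 < σ) (m : ℕ) :
    ∫ x in (0 : ℝ)..1, x ^ (σ - 1) * (1 - x) ^ m =
      m.factorial / (ascPochhammer ℝ (m + 1)).eval σ := by
  induction m generalizing σ with
  | zero =>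
    simp only [pow_zero, mul_one]
    rw [integral_rpow (Or.inl (by linarith))]
    simp [hσ.ne']
  | succ m ih =>
    have hσ' : 0 < σ + 1 := by linarith
    have hint : ∀ τ : ℝ, 0 < τ →
        IntervalIntegrable (fun x : ℝ => x ^ (τ - 1) * (1 - x) ^ m) volume 0 1 := fun τ hτ =>
      intervalIntegrable_rpow_mul hτ (by fun_prop) 0 1
    have h : ∀ x ∈ Set.uIcc (0 : ℝ) 1, x ^ (σ - 1) * (1 - x) ^ (m + 1) =
        x ^ (σ - 1) * (1 - x) ^ m - x ^ (σ + 1 - 1) * (1 - x) ^ m := by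
      intro x hx
      rw [Set.uIcc_of_le zero_le_one] at hx
      rw [show σ + 1 - 1 = σ - 1 + 1 by ring,
        Real.rpow_add_one' hx.1 (by rw [sub_add_cancel]; exact hσ.ne')]
      ring
    rw [intervalIntegral.integral_congr h,
      intervalIntegral.integral_sub (hint σ hσ) (hint _ hσ'), ih hσ, ih hσ']
    have h1 : (ascPochhammer ℝ (m + 1 + 1)).eval σ =
        (ascPochhammer ℝ (m + 1)).eval σ * (σ + (m + 1)) := by
      rw [ascPochhammer_succ_eval]; push_cast; ring
    have h2 : (ascPochhammer ℝ (m + 1 + 1)).eval σ =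
        σ * (ascPochhammer ℝ (m + 1)).eval (σ + 1) := by
      rw [add_comm (m + 1) 1, eval_ascPochhammer_add]; simp
    have p1 := ascPochhammer_pos (m + 1) σ hσ
    have p2 := ascPochhammer_pos (m + 1) (σ + 1) hσ'
    have h3 := h1.symm.trans h2
    rw [h1, Nat.factorial_succ]
    have p3 : 0 < σ + (m + 1) := by positivity
    push_cast
    field_simp
    linear_combination -h3

section

variable {s : ℝ}

lemma natDegree_jacobi_le (s : ℝ) (n : ℕ) : (jacobi s n).natDegree ≤ n := by
  refine natDegree_sum_le_of_forall_le _ _ fun j hj => ?_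
  have hj' : j + (n - j) = n := Nat.add_sub_of_le (Nat.lt_succ_iff.1 (Finset.mem_range.1 hj))
  refine (natDegree_C_mul_le _ _).trans (natDegree_mul_le.trans ?_)
  have h1 : (X ^ j : ℝ[X]).natDegree ≤ j := natDegree_X_pow_le j
  have h2 : ((X - 1 : ℝ[X]) ^ (n - j)).natDegree ≤ n - j := by
    refine natDegree_pow_le.trans ?_
    have : (X - 1 : ℝ[X]).natDegree ≤ 1 := natDegree_X_sub_C_le 1
    nlinarith
  omega

lemma eval_one_jacobi (hs : 0 < s) (n : ℕ) : (jacobi s n).eval 1 = 1 := by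
  rw [jacobi, eval_finsetSum, Finset.sum_range_succ, Finset.sum_eq_zero]
  · simp [(laguerreNorm_pos hs n).ne']
  · intro j hj
    have : n - j ≠ 0 := Nat.sub_ne_zero_of_lt (Finset.mem_range.1 hj)
    simp [this]

/-- The moments of a Jacobi polynomial are proportional to those of a Laguerre polynomial
(`gammaFunctional_X_pow_mul_laguerre`). -/
lemma integral_rpow_mul_pow_mul_jacobi (hs : 0 < s) (i n : ℕ) :
    ∫ x in (0 : ℝ)..1, x ^ (s - 1) * (x ^ i * (jacobi s n).eval x) =
      (-1) ^ n * n.factorial / (laguerreNorm s n * (ascPochhammer ℝ (i + n + 1)).eval s) *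
        ∑ j ∈ range (n + 1), (-1) ^ j * n.choose j * (ascPochhammer ℝ i).eval (s + j) := by
  have hexp : ∀ x : ℝ, x ^ (s - 1) * (x ^ i * (jacobi s n).eval x) =
      ∑ j ∈ range (n + 1), (n.choose j) ^ 2 * laguerreNorm s j / laguerreNorm s n *
        (x ^ (s - 1) * (X ^ i * (X ^ j * (X - 1) ^ (n - j)) : ℝ[X]).eval x) := by
    intro x
    rw [jacobi, eval_finsetSum, Finset.mul_sum, Finset.mul_sum]
    refine Finset.sum_congr rfl fun j _ => ?_
    simp only [eval_mul, eval_C, eval_pow, eval_X]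
    ring
  simp only [hexp]
  rw [intervalIntegral.integral_finsetSum fun j _ =>
    (intervalIntegrable_rpow_mul_eval hs _ 0 1).const_mul _, Finset.mul_sum]
  refine Finset.sum_congr rfl fun j hj => ?_
  obtain ⟨r, rfl⟩ := Nat.exists_eq_add_of_le (Nat.lt_succ_iff.1 (Finset.mem_range.1 hj))
  have hpos : 0 < s + (j + i : ℕ) := by positivity
  have hx : ∀ x ∈ Set.uIoc (0 : ℝ) 1,
      x ^ (s - 1) * (X ^ i * (X ^ j * (X - 1) ^ (j + r - j)) : ℝ[X]).eval x =
      (-1) ^ r * (x ^ (s + (j + i : ℕ) - 1) * (1 - x) ^ r) := by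
    intro x hx
    rw [Set.uIoc_of_le zero_le_one] at hx
    rw [show s + (j + i : ℕ) - 1 = s - 1 + (j + i : ℕ) by ring, Real.rpow_add_natCast hx.1.ne',
      Nat.add_sub_cancel_left, show (1 - x) = -1 * (x - 1) by ring, mul_pow, pow_add]
    simp only [eval_mul, eval_pow, eval_X, eval_sub, eval_one]
    have : ((-1 : ℝ) ^ r) * (-1) ^ r = 1 := by rw [← mul_pow]; simp
    linear_combination (-(x ^ (s - 1) * x ^ j * x ^ i * (x - 1) ^ r)) * this
  rw [intervalIntegral.integral_const_mul, intervalIntegral.integral_congr_ae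
    (ae_of_all _ hx), intervalIntegral.integral_const_mul, integral_rpow_mul_one_sub_pow hpos]
  have h1 : (ascPochhammer ℝ (i + (j + r) + 1)).eval s = (ascPochhammer ℝ j).eval s *
      (ascPochhammer ℝ i).eval (s + j) * (ascPochhammer ℝ (r + 1)).eval (s + (j + i : ℕ)) := by
    rw [← eval_ascPochhammer_add, ← eval_ascPochhammer_add]
    congr 2
    omega
  have h2 : ((j + r).choose j : ℝ) * j.factorial * r.factorial = (j + r).factorial := by
    rw [Nat.choose_symm_add]
    exact_mod_cast Nat.add_choose_mul_factorial_mul_factorial j r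
  have hn := (laguerreNorm_pos hs (j + r)).ne'
  have p1 := (ascPochhammer_pos j s hs).ne'
  have p2 := (ascPochhammer_pos i (s + j) (by positivity)).ne'
  have p3 := (ascPochhammer_pos (r + 1) _ hpos).ne'
  have h3 : (-1 : ℝ) ^ (j + r) * (-1) ^ j = (-1) ^ r := by
    rw [pow_add, mul_right_comm, ← mul_pow]; simp
  rw [h1, ← h2, ← h3, laguerreNorm]
  field_simp

lemma integral_rpow_mul_jacobi_eq_zero (hs : 0 < s) {q : ℝ[X]} {n : ℕ} (hq : q.degree < n) :
    ∫ x in (0 : ℝ)..1, x ^ (s - 1) * (q * jacobi s n).eval x = 0 := by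
  have hexp : ∀ x : ℝ, x ^ (s - 1) * (q * jacobi s n).eval x =
      ∑ i ∈ range n, q.coeff i * (x ^ (s - 1) * (X ^ i * jacobi s n).eval x) := by
    intro x
    have : q.eval x = ∑ i ∈ range n, q.coeff i * x ^ i := by
      rcases eq_or_ne q 0 with rfl | h0
      · simp
      · exact eval_eq_sum_range' ((natDegree_lt_iff_degree_lt h0).2 hq) x
    rw [eval_mul, this, Finset.sum_mul, Finset.mul_sum]
    refine Finset.sum_congr rfl fun j _ => ?_
    simp only [eval_mul, eval_pow, eval_X]
    ring
  simp only [hexp]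
  rw [intervalIntegral.integral_finsetSum fun j _ =>
    (intervalIntegrable_rpow_mul_eval hs _ 0 1).const_mul _]
  refine Finset.sum_eq_zero fun i hi => ?_
  rw [intervalIntegral.integral_const_mul]
  simp only [eval_mul, eval_pow, eval_X]
  rw [integral_rpow_mul_pow_mul_jacobi hs,
    sum_choose_mul_ascPochhammer_eq_zero s (Finset.mem_range.1 hi), mul_zero, mul_zero]

/-- The norm of a Jacobi polynomial `P` follows from `P 1 = 1` by integrating the derivative of
`x ^ s * P x ^ 2`. -/
lemma integral_rpow_mul_jacobi_sq (hs : 0 < s) (n : ℕ) :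
    (2 * n + s) * ∫ x in (0 : ℝ)..1, x ^ (s - 1) * (jacobi s n * jacobi s n).eval x = 1 := by
  set P := jacobi s n with hP
  -- the leading terms of `X * derivative P` and `n * P` cancel
  set Q := X * derivative P - C (n : ℝ) * P with hQ
  have hdeg : Q.degree < n := by
    rw [degree_lt_iff_coeff_zero]
    intro j hj
    have h1 : (X * derivative P).coeff j = j * P.coeff j := by
      cases j with
      | zero => simp
      | succ j => simp [coeff_derivative, mul_comm]
    rw [hQ, coeff_sub, coeff_C_mul, h1]
    rcases hj.eq_or_lt with rfl | hj
    · ring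
    · rw [coeff_eq_zero_of_natDegree_lt ((natDegree_jacobi_le s n).trans_lt hj)]; ring
  have h0 := integral_rpow_mul_jacobi_eq_zero hs hdeg
  have hint := fun q => intervalIntegrable_rpow_mul_eval hs q 0 1
  have hFTC := intervalIntegral.integral_eq_sub_of_hasDerivAt_of_le (zero_le_one' ℝ)
    (f := fun x => x ^ s * (P * P).eval x)
    (f' := fun x => (2 * n + s) * (x ^ (s - 1) * (P * P).eval x) +
      2 * (x ^ (s - 1) * (Q * P).eval x))
    ((Real.continuous_rpow_const hs.le).mul (P * P).continuous).continuousOn ?_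
    (((hint _).const_mul _).add ((hint _).const_mul _))
  · rw [intervalIntegral.integral_add ((hint _).const_mul _) ((hint _).const_mul _),
      intervalIntegral.integral_const_mul, intervalIntegral.integral_const_mul, h0] at hFTC
    simpa [hP, eval_one_jacobi hs, Real.zero_rpow hs.ne'] using hFTC
  · intro x hx
    have hx0 : x ≠ 0 := hx.1.ne'
    refine ((Real.hasDerivAt_rpow_const (p := s) (Or.inl hx0)).mul
      ((P * P).hasDerivAt x)).congr_deriv ?_
    have : x ^ s = x ^ (s - 1) * x := by
      rw [← Real.rpow_add_one hx0, sub_add_cancel]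
    rw [this, hQ, derivative_mul]
    simp only [eval_add, eval_mul, eval_sub, eval_X, eval_C]
    ring

lemma integral_rpow_mul_jacobi_mul_jacobi (hs : 0 < s) (m n : ℕ) :
    ∫ x in (0 : ℝ)..1, x ^ (s - 1) * (jacobi s m * jacobi s n).eval x =
      if m = n then (2 * n + s)⁻¹ else 0 := by
  split_ifs with h
  · subst h
    exact eq_inv_of_mul_eq_one_right (integral_rpow_mul_jacobi_sq hs m)
  · rcases lt_or_gt_of_ne h with h | h
    · exact integral_rpow_mul_jacobi_eq_zero hs (degree_le_natDegree.trans_lt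
        (by exact_mod_cast (natDegree_jacobi_le s m).trans_lt h))
    · rw [mul_comm]
      exact integral_rpow_mul_jacobi_eq_zero hs (degree_le_natDegree.trans_lt
        (by exact_mod_cast (natDegree_jacobi_le s n).trans_lt h))

/-- Both sides have the same derivative in `k` and equal `1` at `k = 0`. -/
theorem hookSum_eq_integral (hs : 0 < s) (k : ℝ) (n : ℕ) :
    hookSum s k n = ∫ x in (0 : ℝ)..(1 / (1 + k ^ 2)),
      x ^ (s - 1) * ((2 * n + s) * (jacobi s n).eval x ^ 2) := by
  set f : ℝ → ℝ := fun x => x ^ (s - 1) * ((2 * n + s) * (jacobi s n).eval x ^ 2) with hf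
  have hint : ∀ u v, IntervalIntegrable f volume u v := fun u v =>
    intervalIntegrable_rpow_mul hs (by fun_prop) u v
  have hderiv : ∀ k : ℝ, HasDerivAt (fun k => hookSum s k n -
      ∫ x in (0 : ℝ)..(1 / (1 + k ^ 2)), f x) 0 k := by
    intro k
    have ht : (0 : ℝ) < 1 / (1 + k ^ 2) := by positivity
    have hcont : ContinuousOn f (Set.Ioi 0) := by
      refine ContinuousOn.mul (fun x hx => ?_) (by fun_prop)
      exact (Real.continuousAt_rpow_const x _ (Or.inl (ne_of_gt hx))).continuousWithinAt
    have h1 := intervalIntegral.integral_hasDerivAt_right (hint 0 (1 / (1 + k ^ 2)))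
      (hcont.stronglyMeasurableAtFilter isOpen_Ioi _ ht) (hcont.continuousAt (Ioi_mem_nhds ht))
    refine ((hasDerivAt_hookSum hs k n).sub
      (h1.comp k (hasDerivAt_one_div_one_add_sq k))).congr_deriv ?_
    have h2 : (1 / (1 + k ^ 2)) ^ s = (1 / (1 + k ^ 2)) ^ (s - 1) * (1 / (1 + k ^ 2)) := by
      rw [← Real.rpow_add_one ht.ne', sub_add_cancel]
    rw [h2, hf]
    ring
  have hc := is_const_of_deriv_eq_zero (fun k => (hderiv k).differentiableAt)
    (fun k => (hderiv k).deriv) k 0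
  have h0 : ∫ x in (0 : ℝ)..1, f x = 1 := by
    refine Eq.trans ?_ (integral_rpow_mul_jacobi_sq hs n)
    rw [← intervalIntegral.integral_const_mul]
    refine intervalIntegral.integral_congr fun x _ => ?_
    simp only [hf, eval_mul]
    ring
  simp only [hookSum_zero hs, ne_eq, OfNat.ofNat_ne_zero, not_false_eq_true, zero_pow, add_zero,
    div_one, h0, sub_self] at hc
  exact sub_eq_zero.1 hc

lemma sum_hookSum (s k : ℝ) (N : ℕ) :
    ∑ n ∈ range N, hookSum s k n = ∑ m ∈ range N, ∑ n ∈ range N,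
      ‖laguerreFourier s k m n‖ ^ 2 / (laguerreNorm s m * laguerreNorm s n) := by
  induction N with
  | zero => simp
  | succ N ih =>
    have hsymm : ∀ m, laguerreFourier s k N m = laguerreFourier s k m N := fun m => by
      rw [laguerreFourier, laguerreFourier, mul_comm]
    rw [Finset.sum_range_succ, ih, Finset.sum_range_succ _ N, Finset.sum_range_succ _ N]
    simp only [Finset.sum_range_succ _ N, Finset.sum_add_distrib]
    rw [hookSum, Finset.sum_range_succ _ N, add_div, add_div, Finset.sum_div]
    simp only [hsymm, div_div, mul_comm (laguerreNorm s N)]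
    ring

end

/-! ### The Laguerre and Jacobi ensembles -/

/-- The orthonormal polynomials for the Laguerre weight with parameter `s - 1`. -/
noncomputable def orthonormalLaguerre (s : ℝ) (n : ℕ) : ℝ[X] :=
  C (√(Real.Gamma s * laguerreNorm s n))⁻¹ * laguerre s n

/-- The orthonormal polynomials for the weight `x ^ (s - 1)` on `(0, 1)`. -/
noncomputable def orthonormalJacobi (s : ℝ) (n : ℕ) : ℝ[X] :=
  C √(2 * n + s) * jacobi s n

lemma expMoment_orthonormalLaguerre {a : ℝ} (ha : -1 < a) (k : ℝ) (m n : ℕ) :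
    expMoment (laguerreWeight a) (orthonormalLaguerre (a + 1)) k m n =
      (((√(laguerreNorm (a + 1) m))⁻¹ * (√(laguerreNorm (a + 1) n))⁻¹ : ℝ) : ℂ) *
        laguerreFourier (a + 1) k m n := by
  have hs : 0 < a + 1 := by linarith
  have hG : 0 < Real.Gamma (a + 1) := Real.Gamma_pos_of_pos hs
  have h := integral_exp_mul_laguerreWeight ha k
    (orthonormalLaguerre (a + 1) m * orthonormalLaguerre (a + 1) n)
  simp only [eval_mul] at h
  rw [expMoment, h]
  simp only [orthonormalLaguerre, Polynomial.map_mul, map_C, map_laguerre,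
    Complex.ofRealHom_eq_coe]
  rw [mul_mul_mul_comm, ← C_mul, fourierFunctional_C_mul, ← mul_assoc, ← Complex.ofReal_mul,
    ← Complex.ofReal_mul, laguerreFourier]
  congr 2
  have : √(Real.Gamma (a + 1)) * √(Real.Gamma (a + 1)) = Real.Gamma (a + 1) :=
    Real.mul_self_sqrt hG.le
  rw [Real.sqrt_mul hG.le, Real.sqrt_mul hG.le]
  nth_rewrite 1 [← this]
  have h0 : √(Real.Gamma (a + 1)) ≠ 0 := (Real.sqrt_pos.2 hG).ne'
  field_simp

lemma isOrthonormal_laguerre {a : ℝ} (ha : -1 < a) :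
    IsOrthonormal (laguerreWeight a) (orthonormalLaguerre (a + 1)) where
  integrable := integrable_laguerreWeight_mul ha
  natDegree_le n := (natDegree_C_mul_le _ _).trans (natDegree_laguerre_le _ n)
  integral_eq m n := by
    have hs : 0 < a + 1 := by linarith
    apply Complex.ofReal_injective
    have h := expMoment_orthonormalLaguerre ha 0 m n
    rw [laguerreFourier, fourierFunctional_zero_right,
      gammaFunctional_laguerre_mul_laguerre (ofReal_add_natCast_ne_zero hs), expMoment] at h
    simp only [Complex.ofReal_zero, mul_zero, zero_mul, Complex.exp_zero, one_mul] at h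
    rw [← integral_complex_ofReal, h]
    split_ifs with hmn
    · subst hmn
      rw [← ofReal_laguerreNorm, ← Complex.ofReal_mul, ← mul_inv,
        Real.mul_self_sqrt (laguerreNorm_pos hs m).le,
        inv_mul_cancel₀ (laguerreNorm_pos hs m).ne']
    · simp

lemma integral_jacobiWeight_mul (a : ℝ) (f : ℝ → ℝ) :
    ∫ x, jacobiWeight a 0 x * f x = ∫ x in (0 : ℝ)..1, x ^ (a + 1 - 1) * f x := by
  have h : ∀ x, jacobiWeight a 0 x * f x =
      Set.indicator (Set.Ioo 0 1) (fun x => x ^ (a + 1 - 1) * f x) x := fun x => by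
    simp only [jacobiWeight, Real.rpow_zero, mul_one, add_sub_cancel_right, Set.indicator_apply]
    split_ifs <;> simp
  simp only [h]
  rw [integral_indicator measurableSet_Ioo, intervalIntegral.integral_of_le zero_le_one,
    integral_Ioc_eq_integral_Ioo]

lemma isOrthonormal_jacobi {a : ℝ} (ha : -1 < a) :
    IsOrthonormal (jacobiWeight a 0) (orthonormalJacobi (a + 1)) where
  integrable q := by
    have h : ∀ x, jacobiWeight a 0 x * q.eval x =
        Set.indicator (Set.Ioo 0 1) (fun x => x ^ (a + 1 - 1) * q.eval x) x := fun x => by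
      simp only [jacobiWeight, Real.rpow_zero, mul_one, add_sub_cancel_right, Set.indicator_apply]
      split_ifs <;> simp
    simp only [h]
    rw [integrable_indicator_iff measurableSet_Ioo]
    exact ((intervalIntegrable_iff_integrableOn_Ioo_of_le zero_le_one).1
      (intervalIntegrable_rpow_mul_eval (by linarith) q 0 1))
  natDegree_le n := (natDegree_C_mul_le _ _).trans (natDegree_jacobi_le _ n)
  integral_eq m n := by
    have hs : 0 < a + 1 := by linarith
    rw [integral_jacobiWeight_mul a fun x =>
      (orthonormalJacobi (a + 1) m).eval x * (orthonormalJacobi (a + 1) n).eval x]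
    have h : ∀ x : ℝ, x ^ (a + 1 - 1) *
        ((orthonormalJacobi (a + 1) m).eval x * (orthonormalJacobi (a + 1) n).eval x) =
        √(2 * m + (a + 1)) * √(2 * n + (a + 1)) *
          (x ^ (a + 1 - 1) * (jacobi (a + 1) m * jacobi (a + 1) n).eval x) := fun x => by
      simp only [orthonormalJacobi, eval_mul, eval_C]; ring
    simp only [h]
    rw [intervalIntegral.integral_const_mul, integral_rpow_mul_jacobi_mul_jacobi hs]
    split_ifs with hmn
    · subst hmn
      have : 0 < 2 * (m : ℝ) + (a + 1) := by positivity
      rw [Real.mul_self_sqrt this.le, mul_inv_cancel₀ this.ne']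
    · simp

lemma eigenvalueDensity_jacobi_of_mem {a : ℝ} (ha : -1 < a) (N : ℕ) {x : ℝ}
    (hx : x ∈ Set.Ioo (0 : ℝ) 1) :
    eigenvalueDensity (jacobiWeight a 0) N x = ∑ n ∈ range N,
      x ^ (a + 1 - 1) * ((2 * n + (a + 1)) * (jacobi (a + 1) n).eval x ^ 2) := by
  have hs : 0 < a + 1 := by linarith
  rw [(isOrthonormal_jacobi ha).eigenvalueDensity_eq, kernel, Finset.mul_sum, jacobiWeight,
    Set.indicator_of_mem hx]
  refine Finset.sum_congr rfl fun n _ => ?_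
  have h0 : 0 ≤ 2 * (n : ℝ) + (a + 1) := by positivity
  simp only [orthonormalJacobi, eval_mul, eval_C, Real.rpow_zero, mul_one, add_sub_cancel_right]
  have := Real.mul_self_sqrt h0
  linear_combination (x ^ a * (jacobi (a + 1) n).eval x ^ 2) * this

lemma intervalIntegrable_eigenvalueDensity_jacobi {a : ℝ} (ha : -1 < a) (N : ℕ) :
    IntervalIntegrable (eigenvalueDensity (jacobiWeight a 0) N) volume 0 1 := by
  have h : eigenvalueDensity (jacobiWeight a 0) N = fun x => jacobiWeight a 0 x *
      (∑ n ∈ range N, orthonormalJacobi (a + 1) n * orthonormalJacobi (a + 1) n).eval x := by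
    ext x
    rw [(isOrthonormal_jacobi ha).eigenvalueDensity_eq, kernel, eval_finsetSum]
    simp only [eval_mul]
  rw [h]
  exact ((isOrthonormal_jacobi ha).integrable _).intervalIntegrable

lemma integral_eigenvalueDensity_jacobi {a : ℝ} (ha : -1 < a) (N : ℕ) {t : ℝ} (ht0 : 0 ≤ t)
    (ht1 : t ≤ 1) :
    ∫ x in (0 : ℝ)..t, eigenvalueDensity (jacobiWeight a 0) N x = ∑ n ∈ range N,
      ∫ x in (0 : ℝ)..t, x ^ (a + 1 - 1) *
        ((2 * n + (a + 1)) * (jacobi (a + 1) n).eval x ^ 2) := by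
  have hs : 0 < a + 1 := by linarith
  rw [← intervalIntegral.integral_finsetSum fun n _ =>
    intervalIntegrable_rpow_mul hs (by fun_prop) 0 t]
  rw [intervalIntegral.integral_of_le ht0, intervalIntegral.integral_of_le ht0,
    integral_Ioc_eq_integral_Ioo, integral_Ioc_eq_integral_Ioo]
  exact setIntegral_congr_fun measurableSet_Ioo fun x hx =>
    eigenvalueDensity_jacobi_of_mem ha N ⟨hx.1, hx.2.trans_le ht1⟩

/-- The Hilbert–Schmidt norm of the truncated matrix of `exp (i k x)` in the Laguerre basis is a
partial mass of the Jacobi density. -/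
theorem sum_norm_expMoment_sq {a : ℝ} (ha : -1 < a) (N : ℕ) (k : ℝ) :
    ∑ m ∈ range N, ∑ n ∈ range N,
        ‖expMoment (laguerreWeight a) (orthonormalLaguerre (a + 1)) k m n‖ ^ 2 =
      ∫ x in (0 : ℝ)..(1 / (1 + k ^ 2)), eigenvalueDensity (jacobiWeight a 0) N x := by
  have hs : 0 < a + 1 := by linarith
  have ht : 1 / (1 + k ^ 2) ≤ 1 := by
    rw [div_le_one (by positivity)]; nlinarith [sq_nonneg k]
  rw [integral_eigenvalueDensity_jacobi ha N (by positivity) ht]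
  simp only [← hookSum_eq_integral hs]
  rw [sum_hookSum]
  refine Finset.sum_congr rfl fun m _ => Finset.sum_congr rfl fun n _ => ?_
  rw [expMoment_orthonormalLaguerre ha, norm_mul, Complex.norm_real, Real.norm_eq_abs, mul_pow,
    sq_abs, mul_pow, inv_pow, inv_pow, Real.sq_sqrt (laguerreNorm_pos hs m).le,
    Real.sq_sqrt (laguerreNorm_pos hs n).le, ← mul_inv, div_eq_inv_mul]

lemma integral_eigenvalueDensity_jacobi_one {a : ℝ} (ha : -1 < a) (N : ℕ) :
    ∫ x in (0 : ℝ)..1, eigenvalueDensity (jacobiWeight a 0) N x = N := by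
  have hs : 0 < a + 1 := by linarith
  have h : ∀ n, ∫ x in (0 : ℝ)..1, x ^ (a + 1 - 1) *
      ((2 * n + (a + 1)) * (jacobi (a + 1) n).eval x ^ 2) = 1 := fun n => by
    simpa [hookSum_zero hs] using (hookSum_eq_integral hs 0 n).symm
  rw [integral_eigenvalueDensity_jacobi ha N zero_le_one le_rfl]
  simp only [h]
  simp

end UnitaryEnsemble

theorem theorem1 (a : ℝ) (ha : -1 < a) (N : ℕ) (hN : 1 ≤ N) (k : ℝ) :
    IntegrableOn
        (fun p : ℝ × ℝ =>
          Complex.exp (Complex.I * k * (p.1 - p.2)) *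
            (UnitaryEnsemble.truncatedTwoPoint
              (UnitaryEnsemble.laguerreWeight a) N p.1 p.2 : ℂ))
        (Set.Ioi (0 : ℝ) ×ˢ Set.Ioi (0 : ℝ)) ∧
      IntervalIntegrable
        (UnitaryEnsemble.eigenvalueDensity (UnitaryEnsemble.jacobiWeight a 0) N)
        volume 0 1 ∧
      -(∫ p in Set.Ioi (0 : ℝ) ×ˢ Set.Ioi (0 : ℝ),
          Complex.exp (Complex.I * k * (p.1 - p.2)) *
            (UnitaryEnsemble.truncatedTwoPoint
              (UnitaryEnsemble.laguerreWeight a) N p.1 p.2 : ℂ)) =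
        ((∫ x in (0 : ℝ)..(1 / (1 + k ^ 2)),
          UnitaryEnsemble.eigenvalueDensity (UnitaryEnsemble.jacobiWeight a 0) N x : ℝ) : ℂ) ∧
      UnitaryEnsemble.structureFunction (UnitaryEnsemble.laguerreWeight a) N k =
        ∫ x in (1 / (1 + k ^ 2))..1,
          UnitaryEnsemble.eigenvalueDensity (UnitaryEnsemble.jacobiWeight a 0) N x := by
  have hL := UnitaryEnsemble.isOrthonormal_laguerre ha
  have hJ := UnitaryEnsemble.intervalIntegrable_eigenvalueDensity_jacobi ha N
  have hsum := UnitaryEnsemble.sum_norm_expMoment_sq ha N k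
  have ht0 : 0 ≤ 1 / (1 + k ^ 2) := by positivity
  have ht1 : 1 / (1 + k ^ 2) ≤ 1 := by
    rw [div_le_one (by positivity)]; nlinarith [sq_nonneg k]
  have hzero : ∀ p : ℝ × ℝ, p ∉ Set.Ioi (0 : ℝ) ×ˢ Set.Ioi (0 : ℝ) →
      Complex.exp (Complex.I * k * (p.1 - p.2)) * (UnitaryEnsemble.truncatedTwoPoint
        (UnitaryEnsemble.laguerreWeight a) N p.1 p.2 : ℂ) = 0 := by
    intro p hp
    rw [hL.truncatedTwoPoint_eq]
    rcases not_and_or.1 hp with h | h <;>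
      simp [UnitaryEnsemble.laguerreWeight, Set.indicator_of_notMem h]
  refine ⟨(hL.integrable_exp_mul_truncatedTwoPoint N k).integrableOn, hJ, ?_, ?_⟩
  · rw [setIntegral_eq_integral_of_forall_compl_eq_zero hzero,
      hL.integral_exp_mul_truncatedTwoPoint, neg_neg, hsum]
  · rw [hL.structureFunction_eq, hsum, ← UnitaryEnsemble.integral_eigenvalueDensity_jacobi_one ha N]
    refine intervalIntegral.integral_interval_sub_left hJ (hJ.mono_set ?_)
    rw [Set.uIcc_of_le ht0, Set.uIcc_of_le zero_le_one]
    exact Set.Icc_subset_Icc_right ht1
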